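/- A loop of loops of genus $4$ is a trivalent metric graph $\Gamma$ with six vertices $v_1,v_2,v_3,w_1,w_2,w_3$ and, with indices read cyclically modulo $3$, a single edge joining $v_i$ to $w_i$ and two edges joining $w_i$ to $v_{i+1}$; the nine edge lengths are arbitrary positive real numbers. A divisor on $\Gamma$ is a finite $\mathbb{Z}$-linear combination of points of $\Gamma$; it is effective if its coefficients are nonnegative. It is principal if it is $\sum_{p} \operatorname{ord}_p(f)\, p$ for a continuous piecewise linear function $f$ on $\Gamma$ with integer slopes, where $\operatorname{ord}_p(f)$ is the sum of the incoming slopes of $f$ at $p$; two divisors are equivalent if their difference is principal. The rank of a divisor $D$ is $-1$ if $D$ is not equivalent to an effective divisor, and otherwise it is the largest integer $k$ such that for every effective divisor $E$ of degree $k$ there is a divisor $D'$ equivalent to $D$ with $D'-E$ effective. Let $W^r_d(\Gamma)$ be the set of classes of divisors of degree $d$ and rank at least $r$. The Brill-Noether rank $w^r_d(\Gamma)$ is $-1$ if $W^r_d(\Gamma)$ is empty, and otherwise it is the largest integer $\rho$ such that for every effective divisor $E$ of degree $r+\rho$ there is a divisor $D$ of degree $d$ and rank at least $r$ with $D-E$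 effective. Theorem. Let $\Gamma$ be a loop of loops of genus $4$. Then $\Gamma$ has genus $4$ (that is, $|E|-|V|+1=4$ for its numbers $|E|$ of edges and $|V|$ of vertices), and $$w^1_3(\Gamma)=0,$$ which is the Brill-Noether number $\rho(4,1,3)=0$, where $\rho(g,r,d)=g-(r+1)(g-d+r)$. -/

import Mathlib

open Set

/-- A finite metric graph, presented by a combinatorial model: finitely many vertices and edges
(loops and multiple edges are allowed), each edge oriented from `src` to `tgt` for bookkeeping and
isometric to a segment of positive length `len`. -/
structure MetricGraph where
  V : Type
  E : Type
  [fintypeV : Fintype V]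
  [fintypeE : Fintype E]
  src : E → V
  tgt : E → V
  len : E → ℝ
  len_pos : ∀ e, 0 < len e

namespace MetricGraph

attribute [instance] MetricGraph.fintypeV MetricGraph.fintypeE

/-- The points of the metric graph: the vertices, and the points in the interiors of the edges,
given by their distance along the edge from its source. -/
inductive Point (Γ : MetricGraph) : Type
  | vertex (v : Γ.V) : Point Γ
  | inner (e : Γ.E) (t : ℝ) (ht : 0 < t ∧ t < Γ.len e) : Point Γ

variable (Γ : MetricGraph)

/-- The parametrization of the edge `e` by `[0, len e]` (constant outside this interval). -/
noncomputable def edgePoint (e : Γ.E) (t : ℝ) : Γ.Point :=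
  if h₀ : t ≤ 0 then Point.vertex (Γ.src e)
  else if h₁ : Γ.len e ≤ t then Point.vertex (Γ.tgt e)
  else Point.inner e t ⟨not_le.mp h₀, not_le.mp h₁⟩

/-- The genus (first Betti number) of a connected metric graph. -/
def genus : ℤ := (Fintype.card Γ.E : ℤ) - Fintype.card Γ.V + 1

end MetricGraph

/-- `g` is piecewise linear with integer slopes on `[0, L]`: there is a finite set of break points
such that `g` is affine with integer slope on each closed subinterval of `[0, L]` whose interior
contains no break point. (In particular `g` is continuous on `[0, L]`.) -/
def IsIntegerPL (g : ℝ → ℝ) (L : ℝ) : Prop :=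
  ∃ B : Finset ℝ, ∀ a b : ℝ, 0 ≤ a → a < b → b ≤ L → (∀ x ∈ B, x ∉ Ioo a b) →
    ∃ m : ℤ, ∀ t ∈ Icc a b, g t = g a + m * (t - a)

theorem IsIntegerPL.add {g h : ℝ → ℝ} {L : ℝ} (hg : IsIntegerPL g L) (hh : IsIntegerPL h L) :
    IsIntegerPL (fun t => g t + h t) L := by
  classical
  obtain ⟨B, hB⟩ := hg
  obtain ⟨C, hC⟩ := hh
  refine ⟨B ∪ C, fun a b ha hab hb hx => ?_⟩
  obtain ⟨m, hm⟩ := hB a b ha hab hb fun x h => hx x (Finset.mem_union_left _ h)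
  obtain ⟨n, hn⟩ := hC a b ha hab hb fun x h => hx x (Finset.mem_union_right _ h)
  refine ⟨m + n, fun t ht => ?_⟩
  simp only [hm t ht, hn t ht]
  push_cast
  ring

theorem IsIntegerPL.neg {g : ℝ → ℝ} {L : ℝ} (hg : IsIntegerPL g L) :
    IsIntegerPL (fun t => -g t) L := by
  obtain ⟨B, hB⟩ := hg
  refine ⟨B, fun a b ha hab hb hx => ?_⟩
  obtain ⟨m, hm⟩ := hB a b ha hab hb hx
  refine ⟨-m, fun t ht => ?_⟩
  simp only [hm t ht]
  push_cast
  ring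

theorem IsIntegerPL.zero (L : ℝ) : IsIntegerPL (fun _ => 0) L :=
  ⟨∅, fun _ _ _ _ _ _ => ⟨0, fun _ _ => by simp⟩⟩

theorem exists_ball_avoiding (B : Finset ℝ) (t : ℝ) :
    ∃ ε > 0, ∀ x ∈ B, x ≠ t → ε ≤ |x - t| := by
  classical
  induction B using Finset.induction_on with
  | empty => exact ⟨1, one_pos, by simp⟩
  | insert y B _ ih =>
    obtain ⟨ε, hε, h⟩ := ih
    by_cases hy : y = t
    · refine ⟨ε, hε, fun x hx hxt => ?_⟩
      rcases Finset.mem_insert.mp hx with rfl | hx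
      · exact absurd hy hxt
      · exact h x hx hxt
    · refine ⟨min ε |y - t|, lt_min hε (abs_pos.mpr (sub_ne_zero.mpr hy)), fun x hx hxt => ?_⟩
      rcases Finset.mem_insert.mp hx with rfl | hx
      · exact min_le_right _ _
      · exact (min_le_left _ _).trans (h x hx hxt)

theorem IsIntegerPL.differentiableWithinAt_Ici {g : ℝ → ℝ} {L : ℝ} (hg : IsIntegerPL g L) {t : ℝ}
    (h0 : 0 ≤ t) (h1 : t < L) : DifferentiableWithinAt ℝ g (Ici t) t := by
  obtain ⟨B, hB⟩ := hg
  obtain ⟨ε, hε, h⟩ := exists_ball_avoiding B t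
  have hb : t < min (t + ε) L := lt_min (by linarith) h1
  obtain ⟨m, hm⟩ := hB t (min (t + ε) L) h0 hb (min_le_right _ _) fun x hx hx' => by
    have h2 := h x hx hx'.1.ne'
    rw [abs_of_pos (sub_pos.mpr hx'.1)] at h2
    have := hx'.2.trans_le (min_le_left _ _)
    linarith
  have hd : DifferentiableWithinAt ℝ (fun s => g t + m * (s - t)) (Ici t) t := by fun_prop
  refine hd.congr_of_eventuallyEq ?_ (by simp)
  filter_upwards [Icc_mem_nhdsGE hb] with s hs using hm s hs

theorem IsIntegerPL.differentiableWithinAt_Iic {g : ℝ → ℝ} {L : ℝ} (hg : IsIntegerPL g L) {t : ℝ}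
    (h0 : 0 < t) (h1 : t ≤ L) : DifferentiableWithinAt ℝ g (Iic t) t := by
  obtain ⟨B, hB⟩ := hg
  obtain ⟨ε, hε, h⟩ := exists_ball_avoiding B t
  have hb : max (t - ε) 0 < t := max_lt (by linarith) h0
  obtain ⟨m, hm⟩ := hB (max (t - ε) 0) t (le_max_right _ _) hb h1 fun x hx hx' => by
    have h2 := h x hx hx'.2.ne
    rw [abs_of_neg (sub_neg.mpr hx'.2)] at h2
    have := (le_max_left _ _).trans_lt hx'.1
    linarith
  have hd : DifferentiableWithinAt ℝ
      (fun s => g (max (t - ε) 0) + m * (s - max (t - ε) 0)) (Iic t) t := by fun_prop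
  refine hd.congr_of_eventuallyEq ?_ (hm t ⟨hb.le, le_rfl⟩)
  filter_upwards [Icc_mem_nhdsLE hb] with s hs using hm s hs

namespace MetricGraph

variable (Γ : MetricGraph)

/-- `f` is a piecewise linear function with integer slopes on `Γ`. -/
def IsPL (f : Γ.Point → ℝ) : Prop :=
  ∀ e, IsIntegerPL (fun t => f (Γ.edgePoint e t)) (Γ.len e)

/-- The slope of `f` just after the point at distance `t` along `e`, in the direction of `e`. -/
noncomputable def slopeRight (f : Γ.Point → ℝ) (e : Γ.E) (t : ℝ) : ℝ :=
  derivWithin (fun s => f (Γ.edgePoint e s)) (Ici t) t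

/-- The slope of `f` just before the point at distance `t` along `e`, in the direction of `e`. -/
noncomputable def slopeLeft (f : Γ.Point → ℝ) (e : Γ.E) (t : ℝ) : ℝ :=
  derivWithin (fun s => f (Γ.edgePoint e s)) (Iic t) t

open Classical in
/-- The sum of the incoming slopes of `f` at a point. -/
noncomputable def ord (f : Γ.Point → ℝ) : Γ.Point → ℝ
  | .vertex v => ∑ e : Γ.E, ((if Γ.src e = v then -Γ.slopeRight f e 0 else 0) +
      (if Γ.tgt e = v then Γ.slopeLeft f e (Γ.len e) else 0))
  | .inner e t _ => Γ.slopeLeft f e t - Γ.slopeRight f e t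

variable {Γ} in
theorem ord_add {f h : Γ.Point → ℝ} (hf : Γ.IsPL f) (hh : Γ.IsPL h) (p : Γ.Point) :
    Γ.ord (fun q => f q + h q) p = Γ.ord f p + Γ.ord h p := by
  have hR : ∀ e t, 0 ≤ t → t < Γ.len e →
      Γ.slopeRight (fun q => f q + h q) e t = Γ.slopeRight f e t + Γ.slopeRight h e t :=
    fun e t h0 h1 => derivWithin_fun_add ((hf e).differentiableWithinAt_Ici h0 h1)
      ((hh e).differentiableWithinAt_Ici h0 h1)
  have hL : ∀ e t, 0 < t → t ≤ Γ.len e →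
      Γ.slopeLeft (fun q => f q + h q) e t = Γ.slopeLeft f e t + Γ.slopeLeft h e t :=
    fun e t h0 h1 => derivWithin_fun_add ((hf e).differentiableWithinAt_Iic h0 h1)
      ((hh e).differentiableWithinAt_Iic h0 h1)
  cases p with
  | vertex v =>
    simp only [ord]
    rw [← Finset.sum_add_distrib]
    refine Finset.sum_congr rfl fun e _ => ?_
    rw [hR e 0 le_rfl (Γ.len_pos e), hL e _ (Γ.len_pos e) le_rfl]
    split_ifs <;> ring
  | inner e t ht =>
    simp only [ord]
    rw [hR e t ht.1.le ht.2, hL e t ht.1 ht.2.le]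
    ring

variable {Γ} in
theorem ord_neg (f : Γ.Point → ℝ) (p : Γ.Point) :
    Γ.ord (fun q => -f q) p = -Γ.ord f p := by
  have hR : ∀ e t, Γ.slopeRight (fun q => -f q) e t = -Γ.slopeRight f e t :=
    fun e t => derivWithin.fun_neg
  have hL : ∀ e t, Γ.slopeLeft (fun q => -f q) e t = -Γ.slopeLeft f e t :=
    fun e t => derivWithin.fun_neg
  cases p with
  | vertex v =>
    simp only [ord, hR, hL]
    rw [← Finset.sum_neg_distrib]
    refine Finset.sum_congr rfl fun e _ => ?_
    split_ifs <;> ring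
  | inner e t ht =>
    simp only [ord, hR, hL]
    ring

theorem ord_zero (p : Γ.Point) : Γ.ord (fun _ => 0) p = 0 := by
  cases p <;> simp [ord, slopeRight, slopeLeft]

/-- Divisors on `Γ`. Their order is coefficientwise, so `0 ≤ D` says that `D` is effective and
`E ≤ D` that `D - E` is effective; the degree is `Finsupp.degree`. -/
abbrev Divisor : Type := Γ.Point →₀ ℤ

/-- The group of principal divisors: the divisors `∑ ord_p(f) · p` of piecewise linear functions
`f` with integer slopes. -/
def Prin : AddSubgroup Γ.Divisor where
  carrier := {D | ∃ f : Γ.Point → ℝ, Γ.IsPL f ∧ ∀ p, (D p : ℝ) = Γ.ord f p}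
  zero_mem' := ⟨fun _ => 0, fun _ => IsIntegerPL.zero _, fun p => by simp [ord_zero]⟩
  add_mem' := by
    rintro D D' ⟨f, hf, hD⟩ ⟨h, hh, hD'⟩
    exact ⟨fun q => f q + h q, fun e => (hf e).add (hh e), fun p => by
      rw [ord_add hf hh, ← hD, ← hD']
      simp⟩
  neg_mem' := by
    rintro D ⟨f, hf, hD⟩
    exact ⟨fun q => -f q, fun e => (hf e).neg, fun p => by
      rw [ord_neg, ← hD]
      simp⟩

/-- The Picard group of `Γ`. -/
abbrev Pic : Type := Γ.Divisor ⧸ Γ.Prin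

/-- Linear equivalence of divisors. -/
def Equivalent (D D' : Γ.Divisor) : Prop := D - D' ∈ Γ.Prin

/-- `k` is the (Baker–Norine) rank of the divisor `D`: if `D` is equivalent to an effective
divisor, the rank is the largest integer `k` such that for every effective divisor `E` of degree
`k` some divisor `D'` equivalent to `D` has `D' - E` effective; otherwise it is `-1`. -/
def IsRank (D : Γ.Divisor) (k : ℤ) : Prop :=
  ((∃ D' : Γ.Divisor, Γ.Equivalent D' D ∧ 0 ≤ D') ∧
    IsGreatest {k : ℤ | ∀ E : Γ.Divisor, 0 ≤ E → E.degree = k →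
      ∃ D' : Γ.Divisor, Γ.Equivalent D' D ∧ E ≤ D'} k) ∨
  ((¬ ∃ D' : Γ.Divisor, Γ.Equivalent D' D ∧ 0 ≤ D') ∧ k = -1)

/-- `D` has rank at least `r`. -/
def RankAtLeast (D : Γ.Divisor) (r : ℤ) : Prop := ∃ k : ℤ, Γ.IsRank D k ∧ r ≤ k

/-- The Brill–Noether locus `W^r_d`: the classes of the divisors of degree `d` and rank at
least `r`. -/
def brillNoetherLocus (r d : ℤ) : Set Γ.Pic :=
  {c | ∃ D : Γ.Divisor, D.degree = d ∧ Γ.RankAtLeast D r ∧ (QuotientAddGroup.mk D : Γ.Pic) = c}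

/-- `ρ` is the Brill–Noether rank `w^r_d` of `Γ`: if `W^r_d` is nonempty, it is the largest integer
`ρ` such that every effective divisor `E` of degree `r + ρ` is contained in a divisor `D` of
degree `d` and rank at least `r`, that is, `D - E` is effective; if `W^r_d` is empty, it is `-1`. -/
def IsBrillNoetherRank (r d ρ : ℤ) : Prop :=
  ((Γ.brillNoetherLocus r d).Nonempty ∧
    IsGreatest {ρ : ℤ | ∀ E : Γ.Divisor, 0 ≤ E → E.degree = r + ρ →
      ∃ D : Γ.Divisor, D.degree = d ∧ Γ.RankAtLeast D r ∧ E ≤ D} ρ) ∨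
  (Γ.brillNoetherLocus r d = ∅ ∧ ρ = -1)

/-- The Brill–Noether number `ρ(g, r, d) = g - (r + 1)(g - d + r)`, with `g` the genus of `Γ`. -/
def brillNoetherNumber (r d : ℤ) : ℤ := Γ.genus - (r + 1) * (Γ.genus - d + r)

end MetricGraph

/-- The edge lengths of a loop of loops of genus `g` (where `3 ≤ g`), which are arbitrary positive
real numbers. With indices read cyclically modulo `g - 1`, the edge from `v i` to `w i` has length
`single i`, and the two edges from `w i` to `v (i + 1)` have lengths `double i 0`, `double i 1`. -/
structure LoopOfLoops (g : ℕ) where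
  single : Fin (g - 1) → ℝ
  double : Fin (g - 1) → Fin 2 → ℝ
  single_pos : ∀ i, 0 < single i
  double_pos : ∀ i j, 0 < double i j

/-- The metric graph of a loop of loops: `Sum.inl i` is the vertex `v i`, `Sum.inr i` is the
vertex `w i`, and `finRotate` is the cyclic successor `i ↦ i + 1`. -/
def LoopOfLoops.toMetricGraph {g : ℕ} (ℓ : LoopOfLoops g) : MetricGraph where
  V := Fin (g - 1) ⊕ Fin (g - 1)
  E := Fin (g - 1) ⊕ (Fin (g - 1) × Fin 2)
  src := Sum.elim (fun i => Sum.inl i) (fun x => Sum.inr x.1)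
  tgt := Sum.elim (fun i => Sum.inr i) (fun x => Sum.inl (finRotate (g - 1) x.1))
  len := Sum.elim ℓ.single (fun x => ℓ.double x.1 x.2)
  len_pos := by
    rintro (i | x)
    · exact ℓ.single_pos i
    · exact ℓ.double_pos x.1 x.2

/-! Call the edge from `v i` to `w i` spoke i, and the pair of edges from `w i` to `v (i + 1)` loop
i. Chips on the edges of a cut, one on each, may all move by the same distance towards the same side
without changing the class; two chips on one edge may move by the same distance in opposite
directions. The cuts needed are two spokes, the three edges at `w k`, and spoke k together with both
edges of loop k + 1. `sum_moves_mem_prin` proves all these equivalences at once.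

Existence. Let spoke k be a longest one, and let i = k + 1 and j = k + 2, so that loop i is opposite
to spoke k. Such moves carry a suitable divisor of three chips over the whole graph. The choice of
the divisor depends on whether the length of spoke k is at most the sum of the other two spokes,
exceeds it by at most the shorter edge of loop i, or exceeds it by more (`covers_of_triangle`,
`covers_of_long_arcs`, `covers_of_short_arc`). A class that covers every point has rank at least
one, which gives nonemptiness and the bound 0 from below.

Upper bound. Let spoke j be a longest one, i = j - 1 and k = j + 1. Choose p inside an edge of loop
i and q inside an edge of loop j, the two loops at the ends of spoke j. By `not_rank_of_two_arcs` no
p + q + x has rank at least one. The tool is Dhar's burning algorithm (`exists_burnt_set`): a fire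
from a vertex without chips would have to be stopped. The edges of p and q removed, a hexagon
through all vertices remains, and one chip x at a vertex or inside another edge cannot stop a fire
on it. If x shares an edge with p or q, the two chips slide apart until one reaches an end. The only
new case is that both arrive together, and then they are pushed along two spokes, one of them spoke
j, until the chip on the other spoke reaches loop k, whose two edges burn through it. This is where
the maximality of spoke j enters. -/

/-! ### One-sided slopes of piecewise linear functions on a segment -/

namespace IsIntegerPL

variable {g : ℝ → ℝ} {L t : ℝ}

theorem exists_right (hg : IsIntegerPL g L) (h0 : 0 ≤ t) (h1 : t < L) :
    ∃ m : ℤ, derivWithin g (Ici t) t = m ∧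
      ∃ b, t < b ∧ b ≤ L ∧ ∀ u ∈ Icc t b, g u = g t + m * (u - t) := by
  obtain ⟨B, hB⟩ := hg
  obtain ⟨ε, hε, h⟩ := exists_ball_avoiding B t
  have hb : t < min (t + ε) L := lt_min (by linarith) h1
  obtain ⟨m, hm⟩ := hB t (min (t + ε) L) h0 hb (min_le_right _ _) fun x hx hx' => by
    have h2 := h x hx hx'.1.ne'
    rw [abs_of_pos (sub_pos.mpr hx'.1)] at h2
    have := hx'.2.trans_le (min_le_left _ _)
    linarith
  refine ⟨m, ?_, _, hb, min_le_right _ _, hm⟩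
  have hd : HasDerivWithinAt (fun s => g t + m * (s - t)) (m : ℝ) (Ici t) t := by
    simpa using (((hasDerivWithinAt_id t (Ici t)).sub_const t).const_mul (m : ℝ)).const_add (g t)
  refine HasDerivWithinAt.derivWithin ?_ (uniqueDiffOn_Ici t t self_mem_Ici)
  refine hd.congr_of_eventuallyEq ?_ (by simp)
  filter_upwards [Icc_mem_nhdsGE hb] with s hs using hm s hs

theorem exists_left (hg : IsIntegerPL g L) (h0 : 0 < t) (h1 : t ≤ L) :
    ∃ m : ℤ, derivWithin g (Iic t) t = m ∧
      ∃ a, 0 ≤ a ∧ a < t ∧ ∀ u ∈ Icc a t, g u = g t + m * (u - t) := by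
  obtain ⟨B, hB⟩ := hg
  obtain ⟨ε, hε, h⟩ := exists_ball_avoiding B t
  have hb : max (t - ε) 0 < t := max_lt (by linarith) h0
  obtain ⟨m, hm⟩ := hB (max (t - ε) 0) t (le_max_right _ _) hb h1 fun x hx hx' => by
    have h2 := h x hx hx'.2.ne
    rw [abs_of_neg (sub_neg.mpr hx'.2)] at h2
    have := (le_max_left _ _).trans_lt hx'.1
    linarith
  have hm' : ∀ u ∈ Icc (max (t - ε) 0) t, g u = g t + m * (u - t) := fun u hu => by
    rw [hm u hu, hm t ⟨hb.le, le_rfl⟩]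
    ring
  refine ⟨m, ?_, _, le_max_right _ _, hb, hm'⟩
  have hd : HasDerivWithinAt (fun s => g t + m * (s - t)) (m : ℝ) (Iic t) t := by
    simpa using (((hasDerivWithinAt_id t (Iic t)).sub_const t).const_mul (m : ℝ)).const_add (g t)
  refine HasDerivWithinAt.derivWithin ?_ (uniqueDiffOn_Iic t t self_mem_Iic)
  refine hd.congr_of_eventuallyEq ?_ (by simp)
  filter_upwards [Icc_mem_nhdsLE hb] with s hs using hm' s hs

theorem continuousOn (hg : IsIntegerPL g L) : ContinuousOn g (Icc 0 L) := by
  intro t ht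
  have h1 : ContinuousWithinAt g (Icc t L) t := by
    rcases ht.2.lt_or_eq with h | h
    · exact (hg.differentiableWithinAt_Ici ht.1 h).continuousWithinAt.mono Icc_subset_Ici_self
    · simp [h]
  have h2 : ContinuousWithinAt g (Icc 0 t) t := by
    rcases ht.1.lt_or_eq with h | h
    · exact (hg.differentiableWithinAt_Iic h ht.2).continuousWithinAt.mono Icc_subset_Iic_self
    · simp [← h]
  rw [← Icc_union_Icc_eq_Icc ht.1 ht.2]
  exact h2.union h1

/-- An affine piece of a function determines its one-sided slopes. -/
theorem derivWithin_of_affine {a b m : ℝ} (hab : a < b)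
    (h : ∀ u ∈ Icc a b, g u = g a + m * (u - a)) :
    derivWithin g (Ici a) a = m ∧ derivWithin g (Iic b) b = m := by
  have hd : ∀ s x, HasDerivWithinAt (fun s => g a + m * (s - a)) m s x := fun s x => by
    simpa using (((hasDerivWithinAt_id x s).sub_const a).const_mul m).const_add (g a)
  constructor
  · refine HasDerivWithinAt.derivWithin ?_ (uniqueDiffOn_Ici a a self_mem_Ici)
    refine (hd _ _).congr_of_eventuallyEq ?_ (by simp)
    filter_upwards [Icc_mem_nhdsGE hab] with s hs using h s hs
  · refine HasDerivWithinAt.derivWithin ?_ (uniqueDiffOn_Iic b b self_mem_Iic)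
    refine (hd _ _).congr_of_eventuallyEq ?_ (h b ⟨hab.le, le_rfl⟩)
    filter_upwards [Icc_mem_nhdsLE hab] with s hs using h s hs

/-- The changes of slope of a piecewise linear function telescope. -/
theorem sum_slope_changes {B : Finset ℝ}
    (hB : ∀ a b : ℝ, 0 ≤ a → a < b → b ≤ L → (∀ x ∈ B, x ∉ Ioo a b) →
      ∃ m : ℤ, ∀ t ∈ Icc a b, g t = g a + m * (t - a)) :
    ∀ (n : ℕ) (a b : ℝ), (B.filter fun x => a < x ∧ x < b).card ≤ n → 0 ≤ a → a < b → b ≤ L →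
      ∑ x ∈ B.filter (fun x => a < x ∧ x < b),
        (derivWithin g (Iic x) x - derivWithin g (Ici x) x) =
        derivWithin g (Ici a) a - derivWithin g (Iic b) b := by
  have base : ∀ a b : ℝ, (B.filter fun x => a < x ∧ x < b) = ∅ → 0 ≤ a → a < b → b ≤ L →
      ∑ x ∈ B.filter (fun x => a < x ∧ x < b),
        (derivWithin g (Iic x) x - derivWithin g (Ici x) x) =
        derivWithin g (Ici a) a - derivWithin g (Iic b) b := by
    intro a b he h0 hab hbL
    obtain ⟨m, hm⟩ := hB a b h0 hab hbL fun x hx hx' => by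
      have : x ∈ B.filter fun x => a < x ∧ x < b := Finset.mem_filter.mpr ⟨hx, hx'⟩
      simp [he] at this
    obtain ⟨h1, h2⟩ := derivWithin_of_affine hab hm
    rw [he, h1, h2]
    simp
  intro n
  induction n with
  | zero => exact fun a b hc => base a b (Finset.card_eq_zero.mp (Nat.le_zero.mp hc))
  | succ n ih =>
    intro a b hc h0 hab hbL
    rcases (B.filter fun x => a < x ∧ x < b).eq_empty_or_nonempty with he | ⟨c, hcm⟩
    · exact base a b he h0 hab hbL
    obtain ⟨hcB, hac, hcb⟩ := Finset.mem_filter.mp hcm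
    have hsplit : (B.filter fun x => a < x ∧ x < b) = insert c
        ((B.filter fun x => a < x ∧ x < c) ∪ (B.filter fun x => c < x ∧ x < b)) := by
      ext x
      simp only [Finset.mem_filter, Finset.mem_insert, Finset.mem_union]
      constructor
      · rintro ⟨hx, h1, h2⟩
        rcases lt_trichotomy x c with h | h | h
        · exact Or.inr (Or.inl ⟨hx, h1, h⟩)
        · exact Or.inl h
        · exact Or.inr (Or.inr ⟨hx, h, h2⟩)
      · rintro (rfl | ⟨hx, h1, h2⟩ | ⟨hx, h1, h2⟩)
        · exact ⟨hcB, hac, hcb⟩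
        · exact ⟨hx, h1, h2.trans hcb⟩
        · exact ⟨hx, hac.trans h1, h2⟩
    have hnot : c ∉ (B.filter fun x => a < x ∧ x < c) ∪ (B.filter fun x => c < x ∧ x < b) := by
      simp
    have hdisj : Disjoint (B.filter fun x => a < x ∧ x < c) (B.filter fun x => c < x ∧ x < b) :=
      Finset.disjoint_filter.mpr fun x _ h1 h2 => lt_asymm h1.2 h2.1
    have hcard : (B.filter fun x => a < x ∧ x < c).card +
        (B.filter fun x => c < x ∧ x < b).card ≤ n := by
      rw [hsplit, Finset.card_insert_of_notMem hnot, Finset.card_union_of_disjoint hdisj] at hc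
      omega
    rw [hsplit, Finset.sum_insert hnot, Finset.sum_union hdisj,
      ih a c (by omega) h0 hac (hcb.le.trans hbL), ih c b (by omega) (h0.trans hac.le) hcb hbL]
    ring

end IsIntegerPL

/-! ### Degree, linear equivalence and rank -/

namespace MetricGraph

variable {Γ : MetricGraph}

theorem edgePoint_zero (e : Γ.E) : Γ.edgePoint e 0 = Point.vertex (Γ.src e) := by
  simp [edgePoint]

theorem edgePoint_len (e : Γ.E) : Γ.edgePoint e (Γ.len e) = Point.vertex (Γ.tgt e) := by
  simp [edgePoint, Γ.len_pos e]

theorem edgePoint_inner (e : Γ.E) {t : ℝ} (ht : 0 < t ∧ t < Γ.len e) :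
    Γ.edgePoint e t = Point.inner e t ht := by
  rw [edgePoint, dif_neg (not_le.mpr ht.1), dif_neg (not_le.mpr ht.2)]

/-- Near a point that is not a break point a single affine piece extends to both sides, so the two
slopes agree. This confines the support of a principal divisor to finitely many known points. -/
theorem ord_inner_eq_zero {f : Γ.Point → ℝ} {e : Γ.E} {B : Finset ℝ}
    (hB : ∀ a b : ℝ, 0 ≤ a → a < b → b ≤ Γ.len e → (∀ x ∈ B, x ∉ Ioo a b) →
      ∃ m : ℤ, ∀ t ∈ Icc a b, f (Γ.edgePoint e t) = f (Γ.edgePoint e a) + m * (t - a))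
    {t : ℝ} (ht : 0 < t ∧ t < Γ.len e) (htB : t ∉ B) : Γ.ord f (Point.inner e t ht) = 0 := by
  obtain ⟨ε, hε, h⟩ := exists_ball_avoiding B t
  have ha : max (t - ε) 0 < t := max_lt (by linarith) ht.1
  have hb : t < min (t + ε) (Γ.len e) := lt_min (by linarith) ht.2
  obtain ⟨m, hm⟩ := hB (max (t - ε) 0) (min (t + ε) (Γ.len e)) (le_max_right _ _) (ha.trans hb)
    (min_le_right _ _) fun x hx hx' => by
      have h1 := h x hx fun h => htB (h ▸ hx)
      have h2 := (le_max_left _ _).trans_lt hx'.1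
      have h3 := hx'.2.trans_le (min_le_left _ _)
      rw [le_abs] at h1
      rcases h1 with h1 | h1 <;> linarith
  have hl : ∀ u ∈ Icc (max (t - ε) 0) t,
      f (Γ.edgePoint e u) = f (Γ.edgePoint e (max (t - ε) 0)) + m * (u - max (t - ε) 0) :=
    fun u hu => hm u ⟨hu.1, hu.2.trans hb.le⟩
  have hr : ∀ u ∈ Icc t (min (t + ε) (Γ.len e)),
      f (Γ.edgePoint e u) = f (Γ.edgePoint e t) + m * (u - t) := fun u hu => by
    rw [hm u ⟨ha.le.trans hu.1, hu.2⟩, hm t ⟨ha.le, hb.le⟩]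
    ring
  simp only [ord, slopeLeft, slopeRight]
  rw [(IsIntegerPL.derivWithin_of_affine ha hl).2, (IsIntegerPL.derivWithin_of_affine hb hr).1]
  ring

/-- Principal divisors have degree zero. -/
theorem degree_eq_zero_of_mem_prin {D : Γ.Divisor} (hD : D ∈ Γ.Prin) : D.degree = 0 := by
  classical
  obtain ⟨f, hf, hD⟩ := hD
  choose B hB using hf
  have hB' : ∀ e, ∑ x ∈ (B e).filter (fun x => 0 < x ∧ x < Γ.len e),
      (Γ.slopeLeft f e x - Γ.slopeRight f e x) =
        Γ.slopeRight f e 0 - Γ.slopeLeft f e (Γ.len e) := fun e =>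
    IsIntegerPL.sum_slope_changes (hB e) _ 0 (Γ.len e) le_rfl le_rfl (Γ.len_pos e) le_rfl
  -- The support lies in the vertices `W` and the interior break points `F e`. The orders on `F e`
  -- telescope to the initial minus the final slope of `e`, which the two vertex terms of `e`
  -- cancel.
  let F : Γ.E → Finset Γ.Point := fun e =>
    ((B e).filter fun x => 0 < x ∧ x < Γ.len e).image (Γ.edgePoint e)
  have hF : ∀ e, ∑ p ∈ F e, Γ.ord f p = Γ.slopeRight f e 0 - Γ.slopeLeft f e (Γ.len e) := by
    intro e
    rw [← hB' e, Finset.sum_image]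
    · refine Finset.sum_congr rfl fun x hx => ?_
      rw [edgePoint_inner e (Finset.mem_filter.mp hx).2]
      rfl
    · intro x hx y hy hxy
      rw [edgePoint_inner e (Finset.mem_filter.mp hx).2,
        edgePoint_inner e (Finset.mem_filter.mp hy).2] at hxy
      injection hxy
  let W : Finset Γ.Point := Finset.univ.image Point.vertex
  have hW : ∑ p ∈ W, Γ.ord f p =
      ∑ e : Γ.E, (-Γ.slopeRight f e 0 + Γ.slopeLeft f e (Γ.len e)) := by
    rw [Finset.sum_image (fun x _ y _ h => by injection h)]
    simp only [ord]
    rw [Finset.sum_comm]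
    refine Finset.sum_congr rfl fun e _ => ?_
    rw [Finset.sum_add_distrib]
    simp
  have hinner : ∀ e, ∀ p ∈ F e, ∃ t ht, p = Point.inner e t ht := by
    intro e p hp
    obtain ⟨x, hx, rfl⟩ := Finset.mem_image.mp hp
    exact ⟨x, (Finset.mem_filter.mp hx).2, edgePoint_inner e _⟩
  have hFdisj : (↑(Finset.univ : Finset Γ.E) : Set Γ.E).PairwiseDisjoint F := by
    intro e _ e' _ hne
    refine Finset.disjoint_left.mpr fun p hp hp' => hne ?_
    obtain ⟨t, ht, rfl⟩ := hinner e p hp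
    obtain ⟨t', ht', h⟩ := hinner e' _ hp'
    injection h
  have hWdisj : Disjoint W (Finset.univ.biUnion F) := by
    refine Finset.disjoint_left.mpr fun p hp hp' => ?_
    obtain ⟨v, -, rfl⟩ := Finset.mem_image.mp hp
    obtain ⟨e, -, he⟩ := Finset.mem_biUnion.mp hp'
    obtain ⟨t, ht, h⟩ := hinner e _ he
    cases h
  have hsupp : D.support ⊆ W ∪ Finset.univ.biUnion F := by
    intro p hp
    rw [Finsupp.mem_support_iff] at hp
    cases p with
    | vertex v => exact Finset.mem_union_left _ (Finset.mem_image_of_mem _ (Finset.mem_univ v))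
    | inner e t ht =>
      refine Finset.mem_union_right _ (Finset.mem_biUnion.mpr ⟨e, Finset.mem_univ e, ?_⟩)
      refine Finset.mem_image.mpr ⟨t, Finset.mem_filter.mpr ⟨?_, ht⟩, edgePoint_inner e ht⟩
      by_contra htB
      apply hp
      have := hD (Point.inner e t ht)
      rw [ord_inner_eq_zero (hB e) ht htB] at this
      exact_mod_cast this
  have hdeg : (D.degree : ℝ) = ∑ p ∈ W ∪ Finset.univ.biUnion F, Γ.ord f p := by
    rw [Finsupp.degree_apply, Finset.sum_subset hsupp fun p _ hp =>
      Finsupp.notMem_support_iff.mp hp]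
    push_cast
    exact Finset.sum_congr rfl fun p _ => hD p
  rw [Finset.sum_union hWdisj, Finset.sum_biUnion hFdisj, hW, Finset.sum_congr rfl fun e _ => hF e,
    ← Finset.sum_add_distrib] at hdeg
  simpa using hdeg

theorem Equivalent.degree_eq {D D' : Γ.Divisor} (h : Γ.Equivalent D D') :
    D.degree = D'.degree := by
  have := degree_eq_zero_of_mem_prin h
  rwa [map_sub, sub_eq_zero] at this

theorem Equivalent.refl (D : Γ.Divisor) : Γ.Equivalent D D := by
  simp [Equivalent]

theorem Equivalent.symm {D D' : Γ.Divisor} (h : Γ.Equivalent D D') : Γ.Equivalent D' D := by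
  simpa [Equivalent] using Γ.Prin.neg_mem h

theorem Equivalent.trans {D D' D'' : Γ.Divisor} (h : Γ.Equivalent D D')
    (h' : Γ.Equivalent D' D'') : Γ.Equivalent D D'' := by
  simpa [Equivalent] using Γ.Prin.add_mem h h'

theorem Equivalent.congr_left {D D' D'' : Γ.Divisor} (h : Γ.Equivalent D D') (h' : D'' = D) :
    Γ.Equivalent D'' D' :=
  h' ▸ h

theorem degree_mono {D D' : Γ.Divisor} (h : D ≤ D') : D.degree ≤ D'.degree := by
  have h0 : 0 ≤ D' - D := sub_nonneg.mpr h
  have : 0 ≤ (D' - D).degree := by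
    rw [Finsupp.degree_apply]
    exact Finset.sum_nonneg fun p _ => h0 p
  rw [map_sub] at this
  linarith

theorem exists_eq_single {E : Γ.Divisor} (h0 : 0 ≤ E) (h1 : E.degree = 1) :
    ∃ p, E = Finsupp.single p 1 := by
  have hne : E ≠ 0 := fun h => by simp [h] at h1
  obtain ⟨p, hp⟩ := Finsupp.ne_iff.mp hne
  have hp0 : 0 ≤ E p := h0 p
  have hp1 : Finsupp.single p 1 ≤ E := by
    classical
    intro q
    rw [Finsupp.single_apply]
    split_ifs with h
    · subst h
      simp only [Finsupp.coe_zero, Pi.zero_apply, ne_eq] at hp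
      omega
    · exact h0 q
  refine ⟨p, ?_⟩
  have hd : 0 ≤ E - Finsupp.single p 1 := sub_nonneg.mpr hp1
  have hs : (E - Finsupp.single p 1).degree = 0 := by
    rw [map_sub, h1]
    simp
  rw [← sub_eq_zero]
  ext q
  by_contra hq
  rw [Finsupp.degree_apply, Finset.sum_eq_zero_iff_of_nonneg fun r _ => hd r] at hs
  exact hq (hs q (Finsupp.mem_support_iff.mpr hq))

/-- A divisor all of whose points can be reached by equivalent effective divisors has rank at
least one. -/
theorem rankAtLeast_one {D : Γ.Divisor} [Nonempty Γ.V]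
    (h : ∀ p, ∃ D', Γ.Equivalent D' D ∧ Finsupp.single p 1 ≤ D') : Γ.RankAtLeast D 1 := by
  obtain ⟨v⟩ := ‹Nonempty Γ.V›
  let S : Set ℤ := {k : ℤ | ∀ E : Γ.Divisor, 0 ≤ E → E.degree = k →
      ∃ D' : Γ.Divisor, Γ.Equivalent D' D ∧ E ≤ D'}
  have h1 : (1 : ℤ) ∈ S := by
    intro E h0 hE
    obtain ⟨p, rfl⟩ := exists_eq_single h0 hE
    exact h p
  -- The rank is a maximum, so its existence needs a bound: a positive k in `S`, tested on k chips
  -- at one vertex, is at most the degree.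
  have hbdd : ∀ k ∈ S, k ≤ max D.degree 0 := by
    intro k hk
    rcases le_or_gt k 0 with hk0 | hk0
    · exact hk0.trans (le_max_right _ _)
    obtain ⟨D', hD', hle⟩ := hk (Finsupp.single (Point.vertex v) k)
      (Finsupp.single_nonneg.mpr hk0.le) (by simp)
    have := degree_mono hle
    rw [hD'.degree_eq] at this
    simp only [Finsupp.degree_single] at this
    exact this.trans (le_max_left _ _)
  obtain ⟨k, hk, hmax⟩ := Int.exists_greatest_of_bdd (P := (· ∈ S)) ⟨_, hbdd⟩ ⟨1, h1⟩
  refine ⟨k, Or.inl ⟨?_, hk, hmax⟩, hmax 1 h1⟩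
  obtain ⟨D', hD', hle⟩ := h (Point.vertex v)
  exact ⟨D', hD', le_trans (Finsupp.single_nonneg.mpr zero_le_one) hle⟩

/-- The definition speaks only of effective divisors of degree exactly k, the rank itself, so the
test divisor is k chips at `p`. -/
theorem RankAtLeast.exists_single_le {D : Γ.Divisor} (h : Γ.RankAtLeast D 1) (p : Γ.Point) :
    ∃ D', Γ.Equivalent D' D ∧ 0 ≤ D' ∧ 1 ≤ D' p := by
  obtain ⟨k, ⟨-, hk, -⟩ | ⟨-, rfl⟩, h1⟩ := h
  · have hk0 : 0 ≤ Finsupp.single p k := Finsupp.single_nonneg.mpr (by omega)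
    obtain ⟨D', hD', hle⟩ := hk (Finsupp.single p k) hk0 (by simp)
    have := hle p
    rw [Finsupp.single_eq_same] at this
    exact ⟨D', hD', hk0.trans hle, h1.trans this⟩
  · omega

theorem RankAtLeast.congr {D D' : Γ.Divisor} {r : ℤ} (h : Γ.RankAtLeast D r)
    (hD : Γ.Equivalent D' D) : Γ.RankAtLeast D' r := by
  have key : ∀ X, Γ.Equivalent X D' ↔ Γ.Equivalent X D := fun X =>
    ⟨fun hX => hX.trans hD, fun hX => hX.trans hD.symm⟩
  simpa only [RankAtLeast, IsRank, key] using h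

end MetricGraph

/-! ### Ramps and the principal divisors of chip moves -/

/-- The piecewise linear function `t ↦ max (t - s) 0`. -/
theorem isIntegerPL_ramp (s L : ℝ) : IsIntegerPL (fun t => max (t - s) 0) L := by
  refine ⟨{s}, fun a b _ _ _ hx => ?_⟩
  have hs : ¬ (a < s ∧ s < b) := hx s (Finset.mem_singleton_self s)
  rcases le_or_gt s a with h | h
  · refine ⟨1, fun t ht => ?_⟩
    dsimp only
    rw [max_eq_left (by linarith [ht.1]), max_eq_left (by linarith)]
    push_cast
    ring
  · have hb : b ≤ s := not_lt.mp fun h' => hs ⟨h, h'⟩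
    refine ⟨0, fun t ht => ?_⟩
    dsimp only
    rw [max_eq_right (by linarith [ht.2]), max_eq_right (by linarith)]
    simp

theorem IsIntegerPL.const (c L : ℝ) : IsIntegerPL (fun _ => c) L :=
  ⟨∅, fun _ _ _ _ _ _ => ⟨0, fun _ _ => by simp⟩⟩

theorem IsIntegerPL.sum {ι : Type*} (A : Finset ι) (g : ι → ℝ → ℝ) {L : ℝ}
    (h : ∀ k ∈ A, IsIntegerPL (g k) L) : IsIntegerPL (fun t => ∑ k ∈ A, g k t) L := by
  classical
  induction A using Finset.induction_on with
  | empty => simpa using IsIntegerPL.zero L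
  | insert k A hk ih =>
    simp only [Finset.sum_insert hk]
    exact (h k (Finset.mem_insert_self k A)).add
      (ih fun j hj => h j (Finset.mem_insert_of_mem hj))

theorem IsIntegerPL.congr {g h : ℝ → ℝ} {L : ℝ} (hg : IsIntegerPL g L)
    (hgh : ∀ t ∈ Icc 0 L, h t = g t) : IsIntegerPL h L := by
  obtain ⟨B, hB⟩ := hg
  refine ⟨B, fun a b ha hab hb hx => ?_⟩
  obtain ⟨m, hm⟩ := hB a b ha hab hb hx
  refine ⟨m, fun t ht => ?_⟩
  rw [hgh t ⟨ha.trans ht.1, ht.2.trans hb⟩, hgh a ⟨ha, hab.le.trans hb⟩]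
  exact hm t ht

open Classical in
theorem hasDerivWithinAt_ramp_Ici (s t : ℝ) :
    HasDerivWithinAt (fun u => max (u - s) 0) (if s ≤ t then 1 else 0) (Ici t) t := by
  split_ifs with h
  · refine (((hasDerivWithinAt_id t (Ici t)).sub_const s)).congr_of_eventuallyEq ?_ ?_
    · filter_upwards [self_mem_nhdsWithin] with u hu
      exact max_eq_left (by simpa using h.trans hu)
    · exact max_eq_left (by simpa using h)
  · refine (hasDerivWithinAt_const t (Ici t) (0 : ℝ)).congr_of_eventuallyEq ?_ ?_
    · filter_upwards [mem_nhdsWithin_of_mem_nhds (Iio_mem_nhds (not_le.mp h))] with u hu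
      exact max_eq_right (by simpa using (le_of_lt hu : u ≤ s))
    · exact max_eq_right (by linarith)

open Classical in
theorem hasDerivWithinAt_ramp_Iic (s t : ℝ) :
    HasDerivWithinAt (fun u => max (u - s) 0) (if s < t then 1 else 0) (Iic t) t := by
  split_ifs with h
  · refine (((hasDerivWithinAt_id t (Iic t)).sub_const s)).congr_of_eventuallyEq ?_ ?_
    · filter_upwards [mem_nhdsWithin_of_mem_nhds (Ioi_mem_nhds h)] with u hu
      exact max_eq_left (by simpa using (le_of_lt hu : s ≤ u))
    · exact max_eq_left (by simpa using h.le)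
  · refine (hasDerivWithinAt_const t (Iic t) (0 : ℝ)).congr_of_eventuallyEq ?_ ?_
    · filter_upwards [self_mem_nhdsWithin] with u hu
      exact max_eq_right (by simpa using le_trans hu (not_lt.mp h))
    · exact max_eq_right (by linarith)

namespace MetricGraph

variable {Γ : MetricGraph}

open Classical in
theorem single_edgePoint_vertex (e : Γ.E) {t : ℝ} (ht : t ∈ Icc 0 (Γ.len e)) (v : Γ.V) :
    Finsupp.single (Γ.edgePoint e t) (1 : ℤ) (Point.vertex v) =
      (if Γ.src e = v then (if t = 0 then 1 else 0) else 0) +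
        (if Γ.tgt e = v then (if t = Γ.len e then 1 else 0) else 0) := by
  have hL := Γ.len_pos e
  rw [Finsupp.single_apply]
  rcases ht.1.eq_or_lt with rfl | h0
  · rw [edgePoint_zero]
    simp [hL.ne]
  rcases ht.2.eq_or_lt with rfl | h1
  · rw [edgePoint_len]
    simp [hL.ne']
  · rw [edgePoint_inner e ⟨h0, h1⟩]
    simp [h0.ne', h1.ne]

open Classical in
theorem single_edgePoint_inner (e e' : Γ.E) {t u : ℝ} (ht : t ∈ Icc 0 (Γ.len e))
    (hu : 0 < u ∧ u < Γ.len e') :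
    Finsupp.single (Γ.edgePoint e t) (1 : ℤ) (Point.inner e' u hu) =
      if e = e' ∧ t = u then 1 else 0 := by
  rw [Finsupp.single_apply]
  rcases ht.1.eq_or_lt with rfl | h0
  · rw [edgePoint_zero]
    simp [hu.1.ne]
  rcases ht.2.eq_or_lt with rfl | h1
  · rw [edgePoint_len, if_neg (by simp), if_neg]
    rintro ⟨rfl, h⟩
    exact hu.2.ne' h
  · rw [edgePoint_inner e ⟨h0, h1⟩]
    simp

open Classical in
/-- Moving chips along edges gives an equivalent divisor if the signed distances travelled on the
edges are the differences of a potential on the vertices. -/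
theorem sum_moves_mem_prin {ι : Type*} [Fintype ι] (ε : ι → Γ.E) (s t : ι → ℝ) (φ : Γ.V → ℝ)
    (hs : ∀ k, s k ∈ Icc 0 (Γ.len (ε k))) (ht : ∀ k, t k ∈ Icc 0 (Γ.len (ε k)))
    (hφ : ∀ e, φ (Γ.tgt e) - φ (Γ.src e) = ∑ k with ε k = e, (t k - s k)) :
    ∑ k, (Finsupp.single (Γ.edgePoint (ε k) (t k)) (1 : ℤ) -
      Finsupp.single (Γ.edgePoint (ε k) (s k)) 1) ∈ Γ.Prin := by
  -- A chip moving from `s k` to `t k` contributes a difference of two ramps, which bends only at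
  -- these two points, with order -1 at `s k` and +1 at `t k`. Its total increase along the edge is
  -- `t k - s k`, so `hφ` says that `G e` ends at the value of `φ` at the target and the pieces fit
  -- together.
  let G : Γ.E → ℝ → ℝ := fun e u =>
    φ (Γ.src e) + ∑ k with ε k = e, (max (u - s k) 0 + -max (u - t k) 0)
  let f : Γ.Point → ℝ := fun
    | .vertex v => φ v
    | .inner e u _ => G e u
  have hfG : ∀ e, ∀ u ∈ Icc 0 (Γ.len e), f (Γ.edgePoint e u) = G e u := by
    intro e u hu
    rcases hu.1.eq_or_lt with rfl | h0
    · rw [edgePoint_zero]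
      simp only [f, G]
      rw [Finset.sum_eq_zero, add_zero]
      intro k _
      rw [max_eq_right (by linarith [(hs k).1]), max_eq_right (by linarith [(ht k).1])]
      simp
    rcases hu.2.eq_or_lt with rfl | h1
    · rw [edgePoint_len]
      simp only [f, G]
      rw [← sub_eq_iff_eq_add', hφ]
      refine Finset.sum_congr rfl fun k hk => ?_
      obtain rfl := (Finset.mem_filter.mp hk).2
      rw [max_eq_left (by linarith [(hs k).2]), max_eq_left (by linarith [(ht k).2])]
      ring
    · rw [edgePoint_inner e ⟨h0, h1⟩]
  have hR : ∀ e u, 0 ≤ u → u < Γ.len e → Γ.slopeRight f e u =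
      ∑ k with ε k = e, ((if s k ≤ u then 1 else 0) - (if t k ≤ u then 1 else 0)) := by
    intro e u h0 h1
    refine HasDerivWithinAt.derivWithin ?_ (uniqueDiffOn_Ici u u self_mem_Ici)
    have hd : HasDerivWithinAt (G e) (∑ k with ε k = e,
        ((if s k ≤ u then 1 else 0) + -(if t k ≤ u then 1 else 0))) (Ici u) u :=
      (HasDerivWithinAt.fun_sum fun k _ => (hasDerivWithinAt_ramp_Ici (s k) u).add
        (hasDerivWithinAt_ramp_Ici (t k) u).neg).const_add _
    simp only [← sub_eq_add_neg] at hd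
    refine hd.congr_of_eventuallyEq ?_ (hfG e u ⟨h0, h1.le⟩)
    filter_upwards [Icc_mem_nhdsGE h1] with x hx using hfG e x ⟨h0.trans hx.1, hx.2⟩
  have hL : ∀ e u, 0 < u → u ≤ Γ.len e → Γ.slopeLeft f e u =
      ∑ k with ε k = e, ((if s k < u then 1 else 0) - (if t k < u then 1 else 0)) := by
    intro e u h0 h1
    refine HasDerivWithinAt.derivWithin ?_ (uniqueDiffOn_Iic u u self_mem_Iic)
    have hd : HasDerivWithinAt (G e) (∑ k with ε k = e,
        ((if s k < u then 1 else 0) + -(if t k < u then 1 else 0))) (Iic u) u :=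
      (HasDerivWithinAt.fun_sum fun k _ => (hasDerivWithinAt_ramp_Iic (s k) u).add
        (hasDerivWithinAt_ramp_Iic (t k) u).neg).const_add _
    simp only [← sub_eq_add_neg] at hd
    refine hd.congr_of_eventuallyEq ?_ (hfG e u ⟨h0.le, h1⟩)
    filter_upwards [Icc_mem_nhdsLE h0] with x hx using hfG e x ⟨hx.1, hx.2.trans h1⟩
  refine ⟨f, fun e => ?_, fun p => ?_⟩
  · exact ((IsIntegerPL.const _ _).add (IsIntegerPL.sum _ _ fun k _ =>
      (isIntegerPL_ramp _ _).add (isIntegerPL_ramp _ _).neg)).congr (hfG e)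
  · rw [Finsupp.finsetSum_apply]
    simp only [Finsupp.sub_apply]
    cases p with
    | vertex v =>
      simp only [single_edgePoint_vertex _ (hs _), single_edgePoint_vertex _ (ht _), ord]
      rw [← Finset.sum_fiberwise (s := Finset.univ) (g := ε), Int.cast_sum]
      refine Finset.sum_congr rfl fun e _ => ?_
      have hite : ∀ (p : Prop) (g : ι → ℝ), (if p then ∑ k with ε k = e, g k else 0) =
          ∑ k with ε k = e, if p then g k else 0 := by
        intro p g
        split_ifs <;> simp
      rw [hR e 0 le_rfl (Γ.len_pos e), hL e _ (Γ.len_pos e) le_rfl, ← Finset.sum_neg_distrib,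
        Int.cast_sum, hite, hite, ← Finset.sum_add_distrib]
      refine Finset.sum_congr rfl fun k hk => ?_
      obtain rfl := (Finset.mem_filter.mp hk).2
      have h0 : ∀ x ∈ Icc 0 (Γ.len (ε k)), (x ≤ 0 ↔ x = 0) := fun x hx =>
        ⟨fun h => le_antisymm h hx.1, fun h => h.le⟩
      have h1 : ∀ x ∈ Icc 0 (Γ.len (ε k)), (x < Γ.len (ε k) ↔ ¬ x = Γ.len (ε k)) := fun x hx =>
        hx.2.lt_iff_ne
      simp only [h0 _ (hs k), h0 _ (ht k), h1 _ (hs k), h1 _ (ht k), ite_not]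
      push_cast
      split_ifs <;> norm_num
    | inner e u hu =>
      simp only [single_edgePoint_inner _ _ (hs _), single_edgePoint_inner _ _ (ht _), ord]
      rw [hR e u hu.1.le hu.2, hL e u hu.1 hu.2.le, ← Finset.sum_sub_distrib, Finset.sum_filter,
        Int.cast_sum]
      refine Finset.sum_congr rfl fun k _ => ?_
      by_cases hk : ε k = e
      · have h1 : ∀ x : ℝ, (if x < u then (1 : ℝ) else 0) =
            (if x ≤ u then 1 else 0) - (if x = u then 1 else 0) := by
          intro x
          rcases lt_trichotomy x u with h | h | h
          · simp [h, h.le, h.ne]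
          · simp [h]
          · simp [h.not_gt, h.not_ge, h.ne']
        simp only [hk, true_and, if_true, h1]
        push_cast
        ring
      · simp [hk]

end MetricGraph

/-! ### Divisors of three chips and their moves -/

namespace MetricGraph

variable {Γ : MetricGraph}

/-- The divisor `p + q + r`. -/
noncomputable def triple (p q r : Γ.Point) : Γ.Divisor :=
  Finsupp.single p 1 + Finsupp.single q 1 + Finsupp.single r 1

theorem triple_swap (p q r : Γ.Point) : triple p q r = triple q p r := by
  simp only [triple]
  abel

theorem triple_rotate (p q r : Γ.Point) : triple p q r = triple r p q := by
  simp only [triple]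
  abel

theorem triple_swap_right (p q r : Γ.Point) : triple p q r = triple p r q := by
  simp only [triple]
  abel

theorem triple_reverse (p q r : Γ.Point) : triple p q r = triple r q p := by
  simp only [triple]
  abel

theorem degree_triple (p q r : Γ.Point) : (triple p q r).degree = 3 := by
  simp [triple]

theorem single_le_triple (p q r : Γ.Point) : Finsupp.single p 1 ≤ triple p q r := by
  have : ∀ x : Γ.Point, (0 : Γ.Divisor) ≤ Finsupp.single x 1 := fun x =>
    Finsupp.single_nonneg.mpr zero_le_one
  rw [triple, add_assoc]
  exact le_add_of_nonneg_right (add_nonneg (this q) (this r))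

/-- The point `p` lies in the support of an effective divisor of the class of `D`. -/
def Covers (D : Γ.Divisor) (p : Γ.Point) : Prop :=
  ∃ D', Γ.Equivalent D' D ∧ Finsupp.single p 1 ≤ D'

theorem Equivalent.covers {D : Γ.Divisor} {p q r : Γ.Point} (h : Γ.Equivalent (triple p q r) D) :
    Covers D p :=
  ⟨_, h, single_le_triple p q r⟩

open Classical in
theorem equivalent_of_two_moves (e₁ e₂ : Γ.E) {s t s' t' : ℝ} (z : Γ.Point) (φ : Γ.V → ℝ)
    (hs : s ∈ Icc 0 (Γ.len e₁)) (ht : t ∈ Icc 0 (Γ.len e₂)) (hs' : s' ∈ Icc 0 (Γ.len e₁))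
    (ht' : t' ∈ Icc 0 (Γ.len e₂)) (hφ : ∀ e, φ (Γ.tgt e) - φ (Γ.src e) =
      (if e₁ = e then s' - s else 0) + (if e₂ = e then t' - t else 0)) :
    Γ.Equivalent (triple (Γ.edgePoint e₁ s') (Γ.edgePoint e₂ t') z)
      (triple (Γ.edgePoint e₁ s) (Γ.edgePoint e₂ t) z) := by
  have := sum_moves_mem_prin (Γ := Γ) (ι := Fin 2) ![e₁, e₂] ![s, t] ![s', t'] φ
    (Fin.forall_fin_two.mpr ⟨hs, ht⟩) (Fin.forall_fin_two.mpr ⟨hs', ht'⟩)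
    (fun e => by
      rw [hφ, Finset.sum_filter, Fin.sum_univ_two]
      rfl)
  rw [Fin.sum_univ_two] at this
  simp only [Matrix.cons_val_zero, Matrix.cons_val_one] at this
  rw [Equivalent, triple, triple]
  convert this using 1
  abel

open Classical in
theorem equivalent_of_three_moves (e₁ e₂ e₃ : Γ.E) {s t r s' t' r' : ℝ} (φ : Γ.V → ℝ)
    (hs : s ∈ Icc 0 (Γ.len e₁)) (ht : t ∈ Icc 0 (Γ.len e₂)) (hr : r ∈ Icc 0 (Γ.len e₃))
    (hs' : s' ∈ Icc 0 (Γ.len e₁)) (ht' : t' ∈ Icc 0 (Γ.len e₂)) (hr' : r' ∈ Icc 0 (Γ.len e₃))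
    (hφ : ∀ e, φ (Γ.tgt e) - φ (Γ.src e) = (if e₁ = e then s' - s else 0) +
      (if e₂ = e then t' - t else 0) + (if e₃ = e then r' - r else 0)) :
    Γ.Equivalent (triple (Γ.edgePoint e₁ s') (Γ.edgePoint e₂ t') (Γ.edgePoint e₃ r'))
      (triple (Γ.edgePoint e₁ s) (Γ.edgePoint e₂ t) (Γ.edgePoint e₃ r)) := by
  have := sum_moves_mem_prin (Γ := Γ) (ι := Fin 3) ![e₁, e₂, e₃] ![s, t, r] ![s', t', r'] φ
    (by simpa [Fin.forall_fin_succ] using ⟨hs, ht, hr⟩)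
    (by simpa [Fin.forall_fin_succ] using ⟨hs', ht', hr'⟩)
    (fun e => by
      rw [hφ, Finset.sum_filter, Fin.sum_univ_three]
      rfl)
  rw [Fin.sum_univ_three] at this
  simp only [Matrix.cons_val_zero, Matrix.cons_val_one, Matrix.cons_val] at this
  rw [Equivalent, triple, triple]
  convert this using 1
  abel

theorem Equivalent.covers_snd {D : Γ.Divisor} {p q r : Γ.Point}
    (h : Γ.Equivalent (triple p q r) D) : Covers D q :=
  (triple_swap p q r ▸ h : Γ.Equivalent _ _).covers

theorem Equivalent.covers_thd {D : Γ.Divisor} {p q r : Γ.Point}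
    (h : Γ.Equivalent (triple p q r) D) : Covers D r :=
  (triple_rotate p q r ▸ h : Γ.Equivalent _ _).covers

/-- Two chips on an edge may move by the same distance in opposite directions. -/
theorem equivalent_pair (e : Γ.E) {s t s' t' : ℝ} (z : Γ.Point)
    (hs : s ∈ Icc 0 (Γ.len e) := by constructor <;> linarith)
    (ht : t ∈ Icc 0 (Γ.len e) := by constructor <;> linarith)
    (hs' : s' ∈ Icc 0 (Γ.len e) := by constructor <;> linarith)
    (ht' : t' ∈ Icc 0 (Γ.len e) := by constructor <;> linarith)
    (h : s' + t' = s + t := by linarith) :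
    Γ.Equivalent (triple (Γ.edgePoint e s') (Γ.edgePoint e t') z)
      (triple (Γ.edgePoint e s) (Γ.edgePoint e t) z) := by
  refine equivalent_of_two_moves e e z (fun _ => 0) hs ht hs' ht' fun e' => ?_
  split_ifs <;> linarith

/-- While one chip moves from `s` to `u`, the other moves from `t` to `s + t - u`, which stays
between `s` and `t`. -/
theorem Covers.of_pair {D : Γ.Divisor} (e : Γ.E) {s t u : ℝ} {z : Γ.Point}
    (h : Γ.Equivalent (triple (Γ.edgePoint e s) (Γ.edgePoint e t) z) D) (hs : 0 ≤ s)
    (ht : t ≤ Γ.len e) (hsu : s ≤ u) (hut : u ≤ t) : Covers D (Γ.edgePoint e u) := by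
  refine Equivalent.covers ((equivalent_pair e (t' := s + t - u) z ⟨hs, ?_⟩ ⟨?_, ht⟩ ⟨?_, ?_⟩
    ⟨?_, ?_⟩ ?_).trans h) <;> linarith

end MetricGraph

/-! ### Cuts of a loop of loops -/

namespace LoopOfLoops

open MetricGraph

variable (Γ : LoopOfLoops 4)

/-- The cyclic successor of an index. -/
abbrev next (i : Fin (4 - 1)) : Fin (4 - 1) := finRotate (4 - 1) i

/-- The point at distance `t` from `v i` on the edge from `v i` to `w i`. -/
noncomputable abbrev spoke (i : Fin (4 - 1)) (t : ℝ) : Γ.toMetricGraph.Point :=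
  Γ.toMetricGraph.edgePoint (Sum.inl i) t

/-- The point at distance `t` from `w i` on one of the edges from `w i` to `v (i + 1)`. -/
noncomputable abbrev arc (i : Fin (4 - 1)) (ε : Fin 2) (t : ℝ) : Γ.toMetricGraph.Point :=
  Γ.toMetricGraph.edgePoint (Sum.inr (i, ε)) t

abbrev v (i : Fin (4 - 1)) : Γ.toMetricGraph.Point := Point.vertex (Sum.inl i)

abbrev w (i : Fin (4 - 1)) : Γ.toMetricGraph.Point := Point.vertex (Sum.inr i)

theorem next_next_next : ∀ i, next (next (next i)) = i := by decide

theorem eq_or_eq_next : ∀ k i, i = k ∨ i = next k ∨ i = next (next k) := by decide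

theorem spoke_zero (i : Fin (4 - 1)) : Γ.spoke i 0 = Γ.v i := edgePoint_zero _

theorem spoke_single (i : Fin (4 - 1)) : Γ.spoke i (Γ.single i) = Γ.w i :=
  edgePoint_len (Γ := Γ.toMetricGraph) (Sum.inl i)

theorem arc_zero (i : Fin (4 - 1)) (ε : Fin 2) : Γ.arc i ε 0 = Γ.w i := edgePoint_zero _

theorem arc_double (i : Fin (4 - 1)) (ε : Fin 2) : Γ.arc i ε (Γ.double i ε) = Γ.v (next i) :=
  edgePoint_len (Γ := Γ.toMetricGraph) (Sum.inr (i, ε))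

theorem forall_edge {P : Γ.toMetricGraph.E → Prop} (h1 : ∀ i, P (Sum.inl i))
    (h2 : ∀ i ε, P (Sum.inr (i, ε))) : ∀ e, P e := by
  rintro (i | ⟨i, ε⟩)
  · exact h1 i
  · exact h2 i ε

/-- The spokes of i and i + 1 cut off the vertices `w i` and `v (i + 1)`, that is, loop i. The
potential is constant on either side of this cut. -/
theorem equivalent_spokes_next (i : Fin (4 - 1)) {s t s' t' : ℝ}
    (z : Γ.toMetricGraph.Point) (hs : s ∈ Icc 0 (Γ.single i)) (ht : t ∈ Icc 0 (Γ.single (next i)))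
    (hs' : s' ∈ Icc 0 (Γ.single i)) (ht' : t' ∈ Icc 0 (Γ.single (next i)))
    (h : s' + t' = s + t) :
    Γ.toMetricGraph.Equivalent (triple (Γ.spoke i s') (Γ.spoke (next i) t') z)
      (triple (Γ.spoke i s) (Γ.spoke (next i) t) z) := by
  refine equivalent_of_two_moves (Γ := Γ.toMetricGraph) (Sum.inl i) (Sum.inl (next i)) z
    (fun x : Fin (4 - 1) ⊕ Fin (4 - 1) => if x = Sum.inr i ∨ x = Sum.inl (next i) then s' - s else 0)
    hs ht hs' ht' ?_
  have hst : t' - t = -(s' - s) := by linarith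
  refine Γ.forall_edge (fun j => ?_) fun j ε => ?_ <;>
    simp only [toMetricGraph, Sum.elim_inl, Sum.elim_inr, Sum.inl.injEq, Sum.inr.injEq,
      reduceCtorEq, false_or, or_false, hst] <;>
    fin_cases i <;> fin_cases j <;> simp [next]

/-- Two chips on different edges of a cut formed by two spokes may move by the same distance in
opposite directions. -/
theorem equivalent_spokes {i j : Fin (4 - 1)} (hij : i ≠ j) {s t s' t' : ℝ}
    (z : Γ.toMetricGraph.Point) (hs : s ∈ Icc 0 (Γ.single i) := by constructor <;> linarith)
    (ht : t ∈ Icc 0 (Γ.single j) := by constructor <;> linarith)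
    (hs' : s' ∈ Icc 0 (Γ.single i) := by constructor <;> linarith)
    (ht' : t' ∈ Icc 0 (Γ.single j) := by constructor <;> linarith)
    (h : s' + t' = s + t := by linarith) :
    Γ.toMetricGraph.Equivalent (triple (Γ.spoke i s') (Γ.spoke j t') z)
      (triple (Γ.spoke i s) (Γ.spoke j t) z) := by
  rcases eq_or_eq_next i j with rfl | rfl | rfl
  · exact absurd rfl hij
  · exact Γ.equivalent_spokes_next i z hs ht hs' ht' h
  · rw [triple_swap, triple_swap (Γ.spoke i s)]
    have := Γ.equivalent_spokes_next (next (next i)) (s := t) (s' := t') (t := s) (t' := s') z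
    rw [next_next_next] at this
    exact this ht hs ht' hs' (by linarith)

/-- Two chips on the two edges of a loop and a third one on the opposite spoke may move by the same
distance. -/
theorem equivalent_arcs_next {i k : Fin (4 - 1)} (hi : next k = i) {s t r s' t' r' : ℝ}
    (ε ε' : Fin 2) (hε : ε ≠ ε')
    (hs : s ∈ Icc 0 (Γ.double i ε) := by constructor <;> linarith)
    (ht : t ∈ Icc 0 (Γ.double i ε') := by constructor <;> linarith)
    (hr : r ∈ Icc 0 (Γ.single k) := by constructor <;> linarith)
    (hs' : s' ∈ Icc 0 (Γ.double i ε) := by constructor <;> linarith)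
    (ht' : t' ∈ Icc 0 (Γ.double i ε') := by constructor <;> linarith)
    (hr' : r' ∈ Icc 0 (Γ.single k) := by constructor <;> linarith)
    (h : t' - t = s' - s := by linarith) (h' : r' - r = -(s' - s) := by linarith) :
    Γ.toMetricGraph.Equivalent
      (triple (Γ.arc i ε s') (Γ.arc i ε' t') (Γ.spoke k r'))
      (triple (Γ.arc i ε s) (Γ.arc i ε' t) (Γ.spoke k r)) := by
  subst hi
  -- Spoke k and the two edges of loop k + 1 cut off `v k`, `v (k + 2)` and `w (k + 2)`; the
  -- potential is constant on either side.
  refine equivalent_of_three_moves (Γ := Γ.toMetricGraph) (Sum.inr (next k, ε))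
    (Sum.inr (next k, ε')) (Sum.inl k)
    (fun x : Fin (4 - 1) ⊕ Fin (4 - 1) => if x = Sum.inl k ∨ x = Sum.inl (next (next k)) ∨
      x = Sum.inr (next (next k)) then s' - s else 0) hs ht hr hs' ht' hr' ?_
  refine Γ.forall_edge (fun j => ?_) fun j η => ?_ <;>
    simp only [toMetricGraph, Sum.elim_inl, Sum.elim_inr, Sum.inl.injEq, Sum.inr.injEq,
      reduceCtorEq, false_or, or_false, h, h', Prod.mk.injEq] <;>
    fin_cases k <;> fin_cases j <;> fin_cases ε <;> fin_cases ε' <;> (try fin_cases η) <;>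
    simp [next] at hε ⊢

/-- Three chips near `w k`, on its three edges, may move by the same distance away from `w k` or
towards it. -/
theorem equivalent_arcs (k : Fin (4 - 1)) {s t r s' t' r' : ℝ} (ε ε' : Fin 2) (hε : ε ≠ ε')
    (hs : s ∈ Icc 0 (Γ.double k ε) := by constructor <;> linarith)
    (ht : t ∈ Icc 0 (Γ.double k ε') := by constructor <;> linarith)
    (hr : r ∈ Icc 0 (Γ.single k) := by constructor <;> linarith)
    (hs' : s' ∈ Icc 0 (Γ.double k ε) := by constructor <;> linarith)
    (ht' : t' ∈ Icc 0 (Γ.double k ε') := by constructor <;> linarith)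
    (hr' : r' ∈ Icc 0 (Γ.single k) := by constructor <;> linarith)
    (h : t' - t = s' - s := by linarith) (h' : r' - r = -(s' - s) := by linarith) :
    Γ.toMetricGraph.Equivalent
      (triple (Γ.arc k ε s') (Γ.arc k ε' t') (Γ.spoke k r'))
      (triple (Γ.arc k ε s) (Γ.arc k ε' t) (Γ.spoke k r)) := by
  refine equivalent_of_three_moves (Γ := Γ.toMetricGraph) (Sum.inr (k, ε)) (Sum.inr (k, ε'))
    (Sum.inl k)
    (fun x : Fin (4 - 1) ⊕ Fin (4 - 1) => if x = Sum.inr k then -(s' - s) else 0)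
    hs ht hr hs' ht' hr' ?_
  refine Γ.forall_edge (fun j => ?_) fun j η => ?_ <;>
    simp only [toMetricGraph, Sum.elim_inl, Sum.elim_inr, Sum.inl.injEq, Sum.inr.injEq,
      reduceCtorEq, h, h', Prod.mk.injEq] <;>
    fin_cases k <;> fin_cases j <;> fin_cases ε <;> fin_cases ε' <;> (try fin_cases η) <;>
    simp at hε ⊢

/-- A divisor covers the whole graph if it covers its edges. -/
theorem covers_of_edges {D : Γ.toMetricGraph.Divisor} {i j k : Fin (4 - 1)} (hi : next k = i)
    (hj : next i = j) (hs₁ : ∀ u, 0 ≤ u → u ≤ Γ.single i → Covers D (Γ.spoke i u))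
    (hs₂ : ∀ u, 0 ≤ u → u ≤ Γ.single j → Covers D (Γ.spoke j u))
    (hs₃ : ∀ u, 0 ≤ u → u ≤ Γ.single k → Covers D (Γ.spoke k u))
    (ha₁ : ∀ ε u, 0 ≤ u → u ≤ Γ.double i ε → Covers D (Γ.arc i ε u))
    (ha₂ : ∀ ε u, 0 ≤ u → u ≤ Γ.double j ε → Covers D (Γ.arc j ε u))
    (ha₃ : ∀ ε u, 0 ≤ u → u ≤ Γ.double k ε → Covers D (Γ.arc k ε u))
    (p : Γ.toMetricGraph.Point) : Covers D p := by
  have hall : ∀ l, l = k ∨ l = i ∨ l = j := fun l => by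
    have := eq_or_eq_next k l
    rwa [hi, hj] at this
  have hs' : ∀ l u, 0 ≤ u → u ≤ Γ.single l → Covers D (Γ.spoke l u) := fun l => by
    rcases hall l with h | h | h <;> rw [h] <;> assumption
  have ha' : ∀ l ε u, 0 ≤ u → u ≤ Γ.double l ε → Covers D (Γ.arc l ε u) := fun l => by
    rcases hall l with h | h | h <;> rw [h] <;> assumption
  have h0 : ∀ i, Covers D (Γ.v i) := fun i => by
    have := hs' i 0 le_rfl (Γ.single_pos i).le
    rwa [spoke_zero] at this
  have h1 : ∀ i, Covers D (Γ.w i) := fun i => by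
    have := hs' i _ (Γ.single_pos i).le le_rfl
    rwa [spoke_single] at this
  cases p with
  | vertex x => rcases x with i | i; exacts [h0 i, h1 i]
  | inner e t ht =>
    rw [← edgePoint_inner]
    rcases e with i | ⟨i, ε⟩
    · exact hs' i t ht.1.le ht.2.le
    · exact ha' i ε t ht.1.le ht.2.le

variable {Γ}

/-- Chips at both vertices of a loop can enter either of its edges from the two ends and sweep it.
-/
theorem covers_arc {D : Γ.toMetricGraph.Divisor} {i j : Fin (4 - 1)} (hj : next i = j)
    {z : Γ.toMetricGraph.Point} (h : Γ.toMetricGraph.Equivalent (triple (Γ.w i) (Γ.v j) z) D)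
    (ε : Fin 2) (u : ℝ) (h0 : 0 ≤ u) (h1 : u ≤ Γ.double i ε) : Covers D (Γ.arc i ε u) := by
  subst hj
  rw [← Γ.arc_zero i ε, ← Γ.arc_double i ε] at h
  exact Covers.of_pair (Γ := Γ.toMetricGraph) (Sum.inr (i, ε)) h le_rfl le_rfl h0 h1

end LoopOfLoops

/-! ### Divisors of degree three and rank at least one -/

namespace LoopOfLoops

open MetricGraph

variable (Γ : LoopOfLoops 4)

theorem ne_next : ∀ i, i ≠ next i := by decide

theorem fin_two_forall {P : Fin 2 → Prop} {ε ε' : Fin 2} (hε : ε ≠ ε') (h : P ε) (h' : P ε')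
    (η : Fin 2) : P η := by
  fin_cases ε <;> fin_cases ε' <;> fin_cases η <;> simp_all

/-- The chip on spoke k first rises to `w k` while spoke i is traversed down to `v i`, and loop k is
swept from `v i` and `w k`. It then descends by the length of spoke j while the chip at `v j` rises
to `w j`, and finally to `v k` while the chip at `v i` rises again. Spoke i is long enough for the
last move exactly by `h`. -/
theorem covers_of_triangle {D : Γ.toMetricGraph.Divisor} {i j k : Fin (4 - 1)}
    (hi : next k = i) (hj : next i = j)
    (hk : next j = k) (hik : Γ.single i ≤ Γ.single k) (hjk : Γ.single j ≤ Γ.single k)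
    (h : Γ.single k ≤ Γ.single i + Γ.single j)
    (h₀ : Γ.toMetricGraph.Equivalent
      (triple (Γ.w i) (Γ.v j) (Γ.spoke k (Γ.single k - Γ.single i))) D) :
    ∀ x, Covers D x := by
  have hne : i ≠ k := hi ▸ (ne_next k).symm
  have hne' : j ≠ k := hk ▸ ne_next j
  have ci := Γ.single_pos i
  have cj := Γ.single_pos j
  have h₁ : ∀ u, 0 ≤ u → u ≤ Γ.single i → Γ.toMetricGraph.Equivalent
      (triple (Γ.spoke i u) (Γ.spoke k (Γ.single k - u)) (Γ.v j)) D := fun u h0 h1 =>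
    (Γ.equivalent_spokes hne (s := Γ.single i) (t := Γ.single k - Γ.single i) _).trans
      (h₀.congr_left (by rw [spoke_single, triple_swap_right]))
  have h₂ : ∀ u, 0 ≤ u → u ≤ Γ.single j → Γ.toMetricGraph.Equivalent
      (triple (Γ.spoke j u) (Γ.spoke k (Γ.single k - u)) (Γ.v i)) D := fun u h0 h1 =>
    (Γ.equivalent_spokes hne' (s := 0) (t := Γ.single k - 0) _).trans
      ((h₁ 0 le_rfl ci.le).congr_left (by rw [spoke_zero, spoke_zero, triple_reverse]))
  have h₃ : ∀ u, 0 ≤ u → u ≤ Γ.single k - Γ.single j → Γ.toMetricGraph.Equivalent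
      (triple (Γ.spoke i u) (Γ.spoke k (Γ.single k - Γ.single j - u)) (Γ.w j)) D := fun u h0 h1 =>
    (Γ.equivalent_spokes hne (s := 0) (t := Γ.single k - Γ.single j) _).trans
      ((h₂ _ cj.le le_rfl).congr_left (by rw [spoke_zero, spoke_single, triple_reverse]))
  refine Γ.covers_of_edges hi hj (fun u h0 h1 => (h₁ u h0 h1).covers)
    (fun u h0 h1 => (h₂ u h0 h1).covers) (fun u h0 h1 => ?_) ?_ ?_ ?_
  · rcases le_total u (Γ.single k - Γ.single j) with h' | h'
    · have := h₃ (Γ.single k - Γ.single j - u) (by linarith) (by linarith)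
      rw [sub_sub_cancel] at this
      exact this.covers_snd
    · have := h₂ (Γ.single k - u) (by linarith) (by linarith)
      rw [sub_sub_cancel] at this
      exact this.covers_snd
  · exact covers_arc hj h₀
  · refine covers_arc hk (z := Γ.spoke i (Γ.single k - Γ.single j))
      ((h₃ _ (sub_nonneg.mpr hjk) le_rfl).congr_left ?_)
    rw [sub_self, spoke_zero, triple_reverse]
  · refine covers_arc hi (z := Γ.v j) ((h₁ 0 le_rfl ci.le).congr_left ?_)
    rw [sub_zero, spoke_single, spoke_zero, triple_swap]

/-- The excess `δ` of spoke k over the other two is absorbed by loop i: while the chip on spoke k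
descends by `δ`, the chip at `w i` advances by `δ` on one edge and the chip at distance `δ` from `v
j` arrives at `v j` on the other. Both edges have room for this by `hδ1`. What the two chips do not
visit in this way is swept by a pair of chips on the same edge. -/
theorem covers_of_long_arcs {D : Γ.toMetricGraph.Divisor} {i j k : Fin (4 - 1)}
    (hi : next k = i) (hj : next i = j)
    (hk : next j = k) {δ : ℝ} (hδ : Γ.single k = Γ.single i + Γ.single j + δ) (hδ0 : 0 ≤ δ)
    (hδ1 : ∀ ε, δ ≤ Γ.double i ε)
    (h₀ : Γ.toMetricGraph.Equivalent (triple (Γ.w i) (Γ.arc i 0 (Γ.double i 0 - δ))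
      (Γ.spoke k (Γ.single k - Γ.single i))) D) :
    ∀ x, Covers D x := by
  have hne : i ≠ k := hi ▸ (ne_next k).symm
  have hne' : j ≠ k := hk ▸ ne_next j
  have ci := Γ.single_pos i
  have cj := Γ.single_pos j
  have a0 := hδ1 0
  have a1 := hδ1 1
  have h₁ : ∀ u, 0 ≤ u → u ≤ Γ.single i → Γ.toMetricGraph.Equivalent
      (triple (Γ.spoke i u) (Γ.spoke k (Γ.single k - u)) (Γ.arc i 0 (Γ.double i 0 - δ))) D :=
    fun u h0 h1 =>
    (Γ.equivalent_spokes hne (s := Γ.single i) (t := Γ.single k - Γ.single i) _).trans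
      (h₀.congr_left (by rw [spoke_single, triple_swap_right]))
  have h₂ : ∀ u, 0 ≤ u → u ≤ δ → Γ.toMetricGraph.Equivalent
      (triple (Γ.arc i 1 u) (Γ.arc i 0 (Γ.double i 0 - δ + u))
        (Γ.spoke k (Γ.single k - Γ.single i - u))) D := fun u h0 h1 =>
    (Γ.equivalent_arcs_next hi (s := 0) (t := Γ.double i 0 - δ)
      (r := Γ.single k - Γ.single i) 1 0 (by decide)).trans
      (h₀.congr_left (by rw [arc_zero]))
  have h₃ : ∀ u, 0 ≤ u → u ≤ Γ.single j → Γ.toMetricGraph.Equivalent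
      (triple (Γ.spoke j u) (Γ.spoke k (Γ.single k - Γ.single i - δ - u)) (Γ.arc i 1 δ)) D :=
    fun u h0 h1 =>
    (Γ.equivalent_spokes hne' (s := 0) (t := Γ.single k - Γ.single i - δ) _).trans
      ((h₂ δ hδ0 le_rfl).congr_left (by
        rw [sub_add_cancel, arc_double, hj, spoke_zero, triple_rotate]))
  refine Γ.covers_of_edges hi hj (fun u h0 h1 => (h₁ u h0 h1).covers)
    (fun u h0 h1 => (h₃ u h0 h1).covers) (fun u h0 h1 => ?_) (fun ε u h0 h1 => ?_) ?_ ?_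
  · rcases le_total u (Γ.single j) with h' | h'
    · have := h₃ (Γ.single j - u) (by linarith) (by linarith)
      rw [show Γ.single k - Γ.single i - δ - (Γ.single j - u) = u by linarith] at this
      exact this.covers_snd
    rcases le_total u (Γ.single k - Γ.single i) with h' | h'
    · have := h₂ (Γ.single k - Γ.single i - u) (by linarith) (by linarith)
      rw [sub_sub_cancel] at this
      exact this.covers_thd
    · have := h₁ (Γ.single k - u) (by linarith) (by linarith)
      rw [sub_sub_cancel] at this
      exact this.covers_snd
  · fin_cases ε
    · rcases le_total u (Γ.double i 0 - δ) with h' | h'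
      · rw [← Γ.arc_zero i 0] at h₀
        exact Covers.of_pair (Γ := Γ.toMetricGraph) (Sum.inr (i, 0)) h₀ le_rfl
          (sub_le_self _ hδ0) h0 h'
      · have := h₂ (u - (Γ.double i 0 - δ)) (by linarith) (by simp at h1; linarith)
        rw [add_sub_cancel] at this
        exact this.covers_snd
    · rcases le_total u δ with h' | h'
      · exact (h₂ u h0 h').covers
      · have := (h₂ δ hδ0 le_rfl)
        rw [sub_add_cancel, arc_double, ← Γ.arc_double i 1] at this
        exact Covers.of_pair (Γ := Γ.toMetricGraph) (Sum.inr (i, 1)) this hδ0 le_rfl h' h1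
  · refine covers_arc hk (z := Γ.arc i 1 δ) ((h₃ _ cj.le le_rfl).congr_left ?_)
    rw [show Γ.single k - Γ.single i - δ - Γ.single j = 0 by linarith, spoke_zero, spoke_single]
  · refine covers_arc hi (z := Γ.arc i 0 (Γ.double i 0 - δ)) ((h₁ 0 le_rfl ci.le).congr_left ?_)
    rw [sub_zero, spoke_single, spoke_zero, triple_swap]

/-- A divisor covers a spoke from some point on and the loop at its end, if that loop can be
reached with two chips at its other vertex or with one chip at each vertex. -/
theorem covers_end {D : Γ.toMetricGraph.Divisor} {i k : Fin (4 - 1)} (hi : next k = i) {x : ℝ}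
    (hx0 : 0 ≤ x) (hxk : x ≤ Γ.single k)
    (h : Γ.toMetricGraph.Equivalent (triple (Γ.v i) (Γ.v i) (Γ.spoke k x)) D) :
    (∀ u, x ≤ u → u ≤ Γ.single k → Covers D (Γ.spoke k u)) ∧
      ∀ ε u, 0 ≤ u → u ≤ Γ.double k ε → Covers D (Γ.arc k ε u) := by
  have key : ∀ ε ε', ε ≠ ε' → ∀ u, 0 ≤ u → u ≤ Γ.double k ε → u ≤ Γ.double k ε' →
      u ≤ Γ.single k - x → Γ.toMetricGraph.Equivalent
        (triple (Γ.arc k ε (Γ.double k ε - u)) (Γ.arc k ε' (Γ.double k ε' - u))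
          (Γ.spoke k (x + u))) D := fun ε ε' hε u h0 h1 h2 h3 =>
    (Γ.equivalent_arcs k (s := Γ.double k ε) (t := Γ.double k ε') (r := x) ε ε' hε).trans
      (h.congr_left (by rw [arc_double, arc_double, hi]))
  -- The three chips approach `w k` together. If the chip on the spoke arrives first, it pairs up
  -- with either chip of the loop to sweep the rest of its edge; otherwise the chip on the shorter
  -- edge arrives first, and it pairs up with the other two.
  by_cases hshort : ∀ ε, Γ.single k - x ≤ Γ.double k ε
  · refine ⟨fun u h0 h1 => ?_, fun ε u h0 h1 => ?_⟩
    · have := key 0 1 (by decide) (u - x) (by linarith) (by linarith [hshort 0])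
        (by linarith [hshort 1]) (by linarith)
      rw [add_sub_cancel] at this
      exact this.covers_thd
    · obtain ⟨ε', hε⟩ : ∃ ε', ε ≠ ε' := (exists_ne ε).imp fun _ => Ne.symm
      rcases le_total (Γ.double k ε - u) (Γ.single k - x) with h' | h'
      · have := key ε ε' hε (Γ.double k ε - u) (by linarith) (by linarith)
          (h'.trans (hshort ε')) h'
        rw [sub_sub_cancel] at this
        exact this.covers
      · have := (key ε ε' hε (Γ.single k - x) (by linarith) (hshort ε) (hshort ε')
          le_rfl).congr_left (D'' := triple (Γ.arc k ε 0)
            (Γ.arc k ε (Γ.double k ε - (Γ.single k - x)))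
            (Γ.arc k ε' (Γ.double k ε' - (Γ.single k - x)))) (by
            rw [arc_zero, add_sub_cancel, spoke_single, triple_rotate, triple_rotate,
              triple_rotate, triple_rotate])
        exact Covers.of_pair (Γ := Γ.toMetricGraph) (Sum.inr (k, ε)) this le_rfl
          (sub_le_self _ (by linarith)) h0 (by linarith)
  · obtain ⟨ε, ε', hε, hle, hlt⟩ : ∃ ε ε', ε ≠ ε' ∧ Γ.double k ε ≤ Γ.double k ε' ∧
        Γ.double k ε ≤ Γ.single k - x := by
      push Not at hshort
      obtain ⟨η, hη⟩ := hshort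
      obtain ⟨η', hne⟩ : ∃ η', η ≠ η' := (exists_ne η).imp fun _ => Ne.symm
      rcases le_total (Γ.double k η) (Γ.double k η') with h' | h'
      · exact ⟨η, η', hne, h', hη.le⟩
      · exact ⟨η', η, hne.symm, h', h'.trans hη.le⟩
    have hpos := Γ.double_pos k ε
    have hend := key ε ε' hε _ hpos.le le_rfl hle hlt
    rw [sub_self] at hend
    refine ⟨fun u h0 h1 => ?_, fin_two_forall hε (fun u h0 h1 => ?_) fun u h0 h1 => ?_⟩
    · rcases le_total (u - x) (Γ.double k ε) with h' | h'
      · have := key ε ε' hε (u - x) (by linarith) h' (h'.trans hle) (by linarith)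
        rw [add_sub_cancel] at this
        exact this.covers_thd
      · rw [arc_zero, ← spoke_single, triple_reverse, triple_swap_right] at hend
        exact Covers.of_pair (Γ := Γ.toMetricGraph) (Sum.inl k) hend (by linarith) le_rfl
          (by linarith) h1
    · have := key ε ε' hε (Γ.double k ε - u) (by linarith) (by linarith) (by linarith)
        (by linarith)
      rw [sub_sub_cancel] at this
      exact this.covers
    · rcases le_total (Γ.double k ε' - u) (Γ.double k ε) with h' | h'
      · have := key ε ε' hε (Γ.double k ε' - u) (by linarith) (by linarith) (by linarith)
          (by linarith)
        rw [sub_sub_cancel] at this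
        exact this.covers_snd
      · rw [arc_zero, ← Γ.arc_zero k ε'] at hend
        exact Covers.of_pair (Γ := Γ.toMetricGraph) (Sum.inr (k, ε')) hend le_rfl
          (sub_le_self _ hpos.le) h0 (by linarith)

/-- From two chips at `w i` there are two directions. Moving into loop i until the shorter edge is
used up brings the chip of spoke k down to the height of spoke j, after which spoke j takes it to `v
k`. Moving down spoke i one after the other raises it, by the length of spoke i each time as far as
spoke k allows. -/
theorem covers_of_short_arc {D : Γ.toMetricGraph.Divisor} {i j k : Fin (4 - 1)}
    (hi : next k = i) (hj : next i = j) (hk : next j = k) {ε ε' : Fin 2} (hε : ε ≠ ε')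
    (hle : Γ.double i ε ≤ Γ.double i ε')
    (hck : Γ.single i + Γ.single j + Γ.double i ε ≤ Γ.single k)
    (h₀ : Γ.toMetricGraph.Equivalent
      (triple (Γ.w i) (Γ.w i) (Γ.spoke k (Γ.single j + Γ.double i ε))) D) :
    ∀ x, Covers D x := by
  have hne : i ≠ k := hi ▸ (ne_next k).symm
  have hne' : j ≠ k := hk ▸ ne_next j
  have ci := Γ.single_pos i
  have cj := Γ.single_pos j
  have ai := Γ.double_pos i ε
  set y := Γ.single j + Γ.double i ε with hy
  set z := Γ.single i + Γ.single j + Γ.double i ε with hz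
  have h₁ : ∀ u, 0 ≤ u → u ≤ Γ.double i ε → Γ.toMetricGraph.Equivalent
      (triple (Γ.arc i ε u) (Γ.arc i ε' u) (Γ.spoke k (y - u))) D := fun u h0 h1 =>
    (Γ.equivalent_arcs_next hi (s := 0) (t := 0) (r := y) ε ε' hε).trans
      (h₀.congr_left (by rw [arc_zero, arc_zero]))
  have h₂ : ∀ u, 0 ≤ u → u ≤ Γ.single j → Γ.toMetricGraph.Equivalent
      (triple (Γ.spoke j u) (Γ.spoke k (y - Γ.double i ε - u)) (Γ.arc i ε' (Γ.double i ε))) D :=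
    fun u h0 h1 =>
    (Γ.equivalent_spokes hne' (s := 0) (t := y - Γ.double i ε) _).trans
      ((h₁ _ ai.le le_rfl).congr_left (by rw [arc_double, hj, spoke_zero, triple_swap_right]))
  have h₃ : ∀ u, 0 ≤ u → u ≤ Γ.single i → Γ.toMetricGraph.Equivalent
      (triple (Γ.spoke i (Γ.single i - u)) (Γ.spoke k (y + u)) (Γ.w i)) D := fun u h0 h1 =>
    (Γ.equivalent_spokes hne (s := Γ.single i) (t := y) _).trans
      (h₀.congr_left (by rw [spoke_single, triple_swap_right]))
  have h₄ : ∀ u, 0 ≤ u → u ≤ Γ.single i → u ≤ Γ.single k - z → Γ.toMetricGraph.Equivalent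
      (triple (Γ.spoke i (Γ.single i - u)) (Γ.spoke k (y + Γ.single i + u)) (Γ.v i)) D :=
    fun u h0 h1 h2 =>
    (Γ.equivalent_spokes hne (s := Γ.single i) (t := y + Γ.single i) _).trans
      ((h₃ _ ci.le le_rfl).congr_left (by rw [sub_self, spoke_zero, spoke_single, triple_reverse]))
  -- While the second chip descends spoke i, either the chip of spoke k reaches `w k`, and loop k is
  -- swept by it and the chip at `v i`, or both chips end at `v i` and `covers_end` takes over.
  obtain ⟨hs, ha⟩ : (∀ u, z ≤ u → u ≤ Γ.single k → Covers D (Γ.spoke k u)) ∧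
      ∀ ε u, 0 ≤ u → u ≤ Γ.double k ε → Covers D (Γ.arc k ε u) := by
    have hs : ∀ u, z ≤ u → u ≤ Γ.single k → u ≤ z + Γ.single i → Covers D (Γ.spoke k u) := by
      intro u h0 h1 h2
      have := h₄ (u - z) (by linarith) (by linarith) (by linarith)
      rw [show y + Γ.single i + (u - z) = u by linarith] at this
      exact this.covers_snd
    rcases le_total (Γ.single k - z) (Γ.single i) with h | h
    · refine ⟨fun u h0 h1 => hs u h0 h1 (by linarith), covers_arc hi
        (z := Γ.spoke i (Γ.single i - (Γ.single k - z)))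
        ((h₄ _ (by linarith) h le_rfl).congr_left ?_)⟩
      rw [show y + Γ.single i + (Γ.single k - z) = Γ.single k by linarith, spoke_single,
        triple_rotate]
    · obtain ⟨h5, h6⟩ := Γ.covers_end hi (x := y + Γ.single i + Γ.single i) (by linarith)
        (by linarith) ((h₄ _ ci.le le_rfl h).congr_left (by
          rw [sub_self, spoke_zero, triple_swap_right]))
      refine ⟨fun u h0 h1 => ?_, h6⟩
      rcases le_total u (z + Γ.single i) with h' | h'
      · exact hs u h0 h1 h'
      · exact h5 u (by linarith) h1
  refine Γ.covers_of_edges hi hj (fun u h0 h1 => ?_) (fun u h0 h1 => (h₂ u h0 h1).covers)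
    (fun u h0 h1 => ?_) (fin_two_forall hε (fun u h0 h1 => (h₁ u h0 h1).covers)
      fun u h0 h1 => ?_) ?_ ha
  · have := h₃ (Γ.single i - u) (by linarith) (by linarith)
    rw [sub_sub_cancel] at this
    exact this.covers
  · rcases le_total u (Γ.single j) with h' | h'
    · have := h₂ (Γ.single j - u) (by linarith) (by linarith)
      rw [show y - Γ.double i ε - (Γ.single j - u) = u by linarith] at this
      exact this.covers_snd
    rcases le_total u y with h' | h'
    · have := h₁ (y - u) (by linarith) (by linarith)
      rw [sub_sub_cancel] at this
      exact this.covers_thd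
    rcases le_total u z with h' | h'
    · have := h₃ (u - y) (by linarith) (by linarith)
      rw [add_sub_cancel] at this
      exact this.covers_snd
    · exact hs u h' h1
  · rcases le_total u (Γ.double i ε) with h' | h'
    · exact (h₁ u h0 h').covers_snd
    · refine Covers.of_pair (Γ := Γ.toMetricGraph) (Sum.inr (i, ε'))
        (z := Γ.spoke k (y - Γ.double i ε)) ((h₁ _ ai.le le_rfl).congr_left ?_) ai.le le_rfl h' h1
      rw [arc_double, ← Γ.arc_double i ε', triple_swap]
      rfl
  · refine covers_arc hk (z := Γ.arc i ε' (Γ.double i ε)) ((h₂ _ cj.le le_rfl).congr_left ?_)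
    rw [show y - Γ.double i ε - Γ.single j = 0 by linarith, spoke_zero, spoke_single]

theorem exists_longest_spoke : ∃ k, ∀ l, Γ.single l ≤ Γ.single k :=
  Finite.exists_max Γ.single

/-- A loop of loops of genus four has a divisor of degree three and rank at least one. -/
theorem exists_rankAtLeast_one :
    ∃ D : Γ.toMetricGraph.Divisor, D.degree = 3 ∧ Γ.toMetricGraph.RankAtLeast D 1 := by
  obtain ⟨k, hk⟩ := Γ.exists_longest_spoke
  obtain ⟨ε, hε⟩ := Finite.exists_min (Γ.double (next k))
  have : Nonempty Γ.toMetricGraph.V := ⟨Sum.inl k⟩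
  have key : ∀ p q r, (∀ x, Covers (Γ := Γ.toMetricGraph) (triple p q r) x) →
      ∃ D : Γ.toMetricGraph.Divisor, D.degree = 3 ∧ Γ.toMetricGraph.RankAtLeast D 1 :=
    fun p q r h => ⟨triple p q r, degree_triple p q r, rankAtLeast_one h⟩
  have h3 := next_next_next k
  -- The cases compare the longest spoke with the sum of the other two, and then its excess with the
  -- shorter edge `ε` of the opposite loop.
  rcases le_or_gt (Γ.single k) (Γ.single (next k) + Γ.single (next (next k))) with h | h
  · exact key _ _ _ (Γ.covers_of_triangle rfl rfl h3 (hk _) (hk _) h (Equivalent.refl _))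
  rcases le_total (Γ.single k)
    (Γ.single (next k) + Γ.single (next (next k)) + Γ.double (next k) ε) with h' | h'
  · exact key _ _ _ (Γ.covers_of_long_arcs rfl rfl h3
      (δ := Γ.single k - Γ.single (next k) - Γ.single (next (next k))) (by ring) (by linarith)
      (fun η => by linarith [hε η]) (Equivalent.refl _))
  · obtain ⟨ε', hne⟩ := exists_ne ε
    exact key _ _ _ (Γ.covers_of_short_arc rfl rfl h3 hne.symm (hε ε') h' (Equivalent.refl _))

end LoopOfLoops

/-! ### Slopes at the minimum of a piecewise linear function -/

namespace IsIntegerPL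

variable {g : ℝ → ℝ} {L m t s : ℝ}

theorem slopeRight_nonneg (hg : IsIntegerPL g L) (hm : ∀ u ∈ Icc 0 L, m ≤ g u) (h0 : 0 ≤ t)
    (h1 : t < L) (ht : g t = m) : 0 ≤ derivWithin g (Ici t) t := by
  obtain ⟨n, hn, b, htb, hbL, h⟩ := hg.exists_right h0 h1
  rw [hn]
  have hb := h b ⟨htb.le, le_rfl⟩
  have := hm b ⟨h0.trans htb.le, hbL⟩
  by_contra hneg
  nlinarith

theorem slopeLeft_nonpos (hg : IsIntegerPL g L) (hm : ∀ u ∈ Icc 0 L, m ≤ g u) (h0 : 0 < t)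
    (h1 : t ≤ L) (ht : g t = m) : derivWithin g (Iic t) t ≤ 0 := by
  obtain ⟨n, hn, a, ha0, hat, h⟩ := hg.exists_left h0 h1
  rw [hn]
  have hb := h a ⟨le_rfl, hat.le⟩
  have := hm a ⟨ha0, hat.le.trans h1⟩
  by_contra hneg
  nlinarith

/-- Integrality is what turns a positive slope into a slope of at least one, hence into a whole
chip. -/
theorem one_le_slopeRight (hg : IsIntegerPL g L) (h0 : 0 ≤ t) (h1 : t < L) (ht : g t = m)
    (hs : t < s) (h : ∀ u, t < u → u ≤ s → m < g u) : 1 ≤ derivWithin g (Ici t) t := by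
  obtain ⟨n, hn, b, htb, -, hb⟩ := hg.exists_right h0 h1
  rw [hn]
  have hlt : t < min b s := lt_min htb hs
  have h2 := hb _ ⟨hlt.le, min_le_left b s⟩
  have h3 := h _ hlt (min_le_right b s)
  have h4 : (0 : ℝ) < n := by
    by_contra hneg
    nlinarith
  exact_mod_cast Int.add_one_le_of_lt (Int.cast_pos.mp h4)

theorem slopeLeft_le_neg_one (hg : IsIntegerPL g L) (h0 : 0 < t) (h1 : t ≤ L) (ht : g t = m)
    (hs : s < t) (h : ∀ u, s ≤ u → u < t → m < g u) : derivWithin g (Iic t) t ≤ -1 := by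
  obtain ⟨n, hn, a, -, hat, ha⟩ := hg.exists_left h0 h1
  rw [hn]
  have hlt : max a s < t := max_lt hat hs
  have h2 := ha _ ⟨le_max_left a s, hlt.le⟩
  have h3 := h _ (le_max_right a s) hlt
  have h4 : (n : ℝ) < 0 := by
    by_contra hneg
    nlinarith
  have h5 : n ≤ -1 := by
    have : n < 0 := by exact_mod_cast h4
    omega
  exact_mod_cast h5

theorem isCompact_level (hg : IsIntegerPL g L) : IsCompact (Icc 0 L ∩ g ⁻¹' {m}) :=
  isCompact_Icc.of_isClosed_subset
    (hg.continuousOn.preimage_isClosed_of_isClosed isClosed_Icc isClosed_singleton)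
    inter_subset_left

/-- The level set of the minimum is compact, and at its first point the function arrives from
strictly larger values. -/
theorem exists_first (hg : IsIntegerPL g L) (hm : ∀ u ∈ Icc 0 L, m ≤ g u) (h0 : m < g 0)
    (ht : t ∈ Icc 0 L) (htm : g t = m) :
    ∃ t₁, 0 < t₁ ∧ t₁ ≤ t ∧ g t₁ = m ∧ derivWithin g (Iic t₁) t₁ ≤ -1 := by
  obtain ⟨t₁, ⟨⟨h1, h2⟩, h3⟩, hleast⟩ := (hg.isCompact_level (m := m)).exists_isLeast ⟨t, ht, htm⟩
  have h3 : g t₁ = m := h3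
  have hpos : 0 < t₁ := h1.lt_of_ne fun h => by
    rw [← h] at h3
    exact h0.ne' h3
  refine ⟨t₁, hpos, hleast ⟨ht, htm⟩, h3, hg.slopeLeft_le_neg_one hpos h2 h3 hpos
    fun u hu hut => (hm u ⟨hu, hut.le.trans h2⟩).lt_of_ne fun h => ?_⟩
  exact hut.not_ge (hleast ⟨⟨hu, hut.le.trans h2⟩, h.symm⟩)

theorem exists_last (hg : IsIntegerPL g L) (hm : ∀ u ∈ Icc 0 L, m ≤ g u) (hL : m < g L)
    (ht : t ∈ Icc 0 L) (htm : g t = m) :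
    ∃ t₂, t ≤ t₂ ∧ t₂ < L ∧ g t₂ = m ∧ 1 ≤ derivWithin g (Ici t₂) t₂ := by
  obtain ⟨t₂, ⟨⟨h1, h2⟩, h3⟩, hgr⟩ := (hg.isCompact_level (m := m)).exists_isGreatest ⟨t, ht, htm⟩
  have h3 : g t₂ = m := h3
  have hlt : t₂ < L := h2.lt_of_ne fun h => by
    rw [h] at h3
    exact hL.ne' h3
  refine ⟨t₂, hgr ⟨ht, htm⟩, hlt, h3, hg.one_le_slopeRight h1 hlt h3 hlt
    fun u htu hu => (hm u ⟨h1.trans htu.le, hu⟩).lt_of_ne fun h => ?_⟩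
  exact htu.not_ge (hgr ⟨⟨h1.trans htu.le, hu⟩, h.symm⟩)

end IsIntegerPL

/-! ### Dhar's burning algorithm -/

namespace MetricGraph

variable {Γ : MetricGraph}

theorem IsPL.exists_min [Nonempty Γ.V] {f : Γ.Point → ℝ} (hf : Γ.IsPL f) :
    ∃ p, ∀ q, f p ≤ f q := by
  have hmin : ∀ e, ∃ t ∈ Icc 0 (Γ.len e), ∀ u ∈ Icc 0 (Γ.len e),
      f (Γ.edgePoint e t) ≤ f (Γ.edgePoint e u) := fun e =>
    isCompact_Icc.exists_isMinOn (nonempty_Icc.mpr (Γ.len_pos e).le) (hf e).continuousOn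
  choose t ht hmin using hmin
  let P : Γ.V ⊕ Γ.E → Γ.Point := Sum.elim Point.vertex fun e => Γ.edgePoint e (t e)
  obtain ⟨x, hx⟩ := Finite.exists_min (f ∘ P)
  refine ⟨P x, fun q => ?_⟩
  cases q with
  | vertex v => exact hx (Sum.inl v)
  | inner e u hu =>
    rw [← edgePoint_inner]
    exact (hx (Sum.inr e)).trans (hmin e u ⟨hu.1.le, hu.2.le⟩)

/-- Dhar's burning algorithm: if `D` has at most one chip inside each edge, and `D'` is an effective
divisor equivalent to `D` with a chip at a vertex `q` without chips of `D`, then a fire starting at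
`q` that spreads along the edges without chips, and is stopped at each vertex by at most as many
burning edges as there are chips of `D`, does not burn all vertices. -/
theorem exists_burnt_set {D D' : Γ.Divisor} (h : Γ.Equivalent D' D) (h0 : 0 ≤ D') {q : Γ.V}
    (hq : D (Point.vertex q) ≤ 0) (hq' : 1 ≤ D' (Point.vertex q))
    (hone : ∀ e, ∃ t₀, ∀ t ht, D (Point.inner e t ht) ≤ 1 ∧
      (t ≠ t₀ → D (Point.inner e t ht) ≤ 0)) :
    ∃ B : Γ.V → Prop, B q ∧ (∃ v, ¬ B v) ∧ ∀ v, ¬ B v → ∀ A : Finset Γ.E,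
      (∀ e ∈ A, (∀ t ht, D (Point.inner e t ht) ≤ 0) ∧
        ((Γ.src e = v ∧ B (Γ.tgt e)) ∨ (Γ.tgt e = v ∧ B (Γ.src e)))) →
      (A.card : ℤ) ≤ D (Point.vertex v) := by
  classical
  obtain ⟨f, hf, hord⟩ := h
  have : Nonempty Γ.V := ⟨q⟩
  obtain ⟨p₀, hp₀⟩ := hf.exists_min
  set m := f p₀ with hm
  -- As `D` plus the divisor of `f` is effective, the outgoing slopes of `f` at a point sum to at
  -- most the number of chips of `D` there. The burnt vertices will be those where `f` exceeds its
  -- minimum `m`.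
  have hord' : ∀ p, -(D p : ℝ) ≤ Γ.ord f p := fun p => by
    have h1 := hord p
    have h2 : (0 : ℝ) ≤ D' p := by exact_mod_cast h0 p
    rw [Finsupp.sub_apply] at h1
    push_cast at h1
    linarith
  have hmin : ∀ e, ∀ u ∈ Icc 0 (Γ.len e), m ≤ f (Γ.edgePoint e u) := fun e u _ => hp₀ _
  have hR : ∀ e t, 0 ≤ t → t < Γ.len e → f (Γ.edgePoint e t) = m → 0 ≤ Γ.slopeRight f e t :=
    fun e t h0 h1 ht => (hf e).slopeRight_nonneg (hmin e) h0 h1 ht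
  have hL : ∀ e t, 0 < t → t ≤ Γ.len e → f (Γ.edgePoint e t) = m → Γ.slopeLeft f e t ≤ 0 :=
    fun e t h0 h1 ht => (hf e).slopeLeft_nonpos (hmin e) h0 h1 ht
  have hsrc : ∀ e, f (Γ.edgePoint e 0) = f (Point.vertex (Γ.src e)) := fun e => by
    rw [edgePoint_zero]
  have htgt : ∀ e, f (Γ.edgePoint e (Γ.len e)) = f (Point.vertex (Γ.tgt e)) := fun e => by
    rw [edgePoint_len]
  have hfirst : ∀ e t, t ∈ Icc 0 (Γ.len e) → f (Γ.edgePoint e t) = m →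
      m < f (Point.vertex (Γ.src e)) → ∃ t₁, 0 < t₁ ∧ t₁ ≤ t ∧ f (Γ.edgePoint e t₁) = m ∧
        Γ.slopeLeft f e t₁ ≤ -1 := fun e t ht htm h =>
    (hf e).exists_first (hmin e) (by rwa [hsrc]) ht htm
  have hlast : ∀ e t, t ∈ Icc 0 (Γ.len e) → f (Γ.edgePoint e t) = m →
      m < f (Point.vertex (Γ.tgt e)) → ∃ t₂, t ≤ t₂ ∧ t₂ < Γ.len e ∧ f (Γ.edgePoint e t₂) = m ∧
        1 ≤ Γ.slopeRight f e t₂ := fun e t ht htm h =>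
    (hf e).exists_last (hmin e) (by rwa [htgt]) ht htm
  have hchip : ∀ e t ht, Γ.slopeRight f e t - Γ.slopeLeft f e t ≤ D (Point.inner e t ht) :=
    fun e t ht => by
      have := hord' (Point.inner e t ht)
      rw [ord] at this
      linarith
  have hvert : ∀ v, ¬ m < f (Point.vertex v) → ∀ A : Finset Γ.E,
      (∀ e ∈ A, (∀ t ht, D (Point.inner e t ht) ≤ 0) ∧
        ((Γ.src e = v ∧ m < f (Point.vertex (Γ.tgt e))) ∨
          (Γ.tgt e = v ∧ m < f (Point.vertex (Γ.src e))))) →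
      Γ.ord f (Point.vertex v) ≤ -(A.card : ℝ) := by
    intro v hv A hA
    have hv : f (Point.vertex v) = m := le_antisymm (not_lt.mp hv) (hp₀ _)
    have hR0 : ∀ e, Γ.src e = v → 0 ≤ Γ.slopeRight f e 0 := fun e he =>
      hR e 0 le_rfl (Γ.len_pos e) (by rw [hsrc, he, hv])
    have hL0 : ∀ e, Γ.tgt e = v → Γ.slopeLeft f e (Γ.len e) ≤ 0 := fun e he =>
      hL e _ (Γ.len_pos e) le_rfl (by rw [htgt, he, hv])
    -- On an edge of `A`, leading from `v` to a burnt vertex, `f` leaves its minimum somewhere. At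
    -- an interior point this would cost a chip, and there is none, so it happens at `v`, with
    -- outgoing slope at least one.
    have hle : ∀ e, ((if Γ.src e = v then -Γ.slopeRight f e 0 else 0) +
        (if Γ.tgt e = v then Γ.slopeLeft f e (Γ.len e) else 0)) ≤ if e ∈ A then -1 else 0 := by
      intro e
      have h1 : (if Γ.src e = v then -Γ.slopeRight f e 0 else 0) ≤ 0 := by
        split_ifs with he
        · linarith [hR0 e he]
        · exact le_rfl
      have h2 : (if Γ.tgt e = v then Γ.slopeLeft f e (Γ.len e) else 0) ≤ 0 := by
        split_ifs with he
        · exact hL0 e he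
        · exact le_rfl
      by_cases heA : e ∈ A
      · rw [if_pos heA]
        obtain ⟨hfree, ⟨he, hB⟩ | ⟨he, hB⟩⟩ := hA e heA
        · obtain ⟨t, ht0, htL, htm, hslope⟩ := hlast e 0 ⟨le_rfl, (Γ.len_pos e).le⟩
            (by rw [hsrc, he, hv]) hB
          rcases ht0.eq_or_lt with rfl | ht0
          · rw [if_pos he]
            linarith
          · have h3 : (D (Point.inner e t ⟨ht0, htL⟩) : ℝ) ≤ 0 := by exact_mod_cast hfree t _
            linarith [hchip e t ⟨ht0, htL⟩, hL e t ht0 htL.le htm]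
        · obtain ⟨t, ht0, htL, htm, hslope⟩ := hfirst e _ ⟨(Γ.len_pos e).le, le_rfl⟩
            (by rw [htgt, he, hv]) hB
          rcases htL.eq_or_lt with rfl | htL
          · rw [if_pos he]
            linarith
          · have h3 : (D (Point.inner e t ⟨ht0, htL⟩) : ℝ) ≤ 0 := by exact_mod_cast hfree t _
            linarith [hchip e t ⟨ht0, htL⟩, hR e t ht0.le htL htm]
      · rw [if_neg heA]
        linarith
    calc Γ.ord f (Point.vertex v) ≤ ∑ e : Γ.E, if e ∈ A then (-1 : ℝ) else 0 :=
          Finset.sum_le_sum fun e _ => hle e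
      _ = -(A.card : ℝ) := by simp
  refine ⟨fun v => m < f (Point.vertex v), ?_, ?_, fun v hv A hA => ?_⟩
  · by_contra hqm
    have h1 := hvert q hqm ∅ (by simp)
    rw [← hord, Finsupp.sub_apply] at h1
    simp only [Finset.card_empty, Nat.cast_zero, neg_zero, Int.cast_nonpos] at h1
    omega
  -- If all vertices burn, the minimum is attained only inside edges. On such an edge, its first and
  -- its last minimum point both need a chip, so they coincide; but then the slope changes there by
  -- at least two, against at most one chip.
  · by_contra! hall
    obtain ⟨e, t, ht, hp⟩ : ∃ e t ht, p₀ = Point.inner e t ht := by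
      cases hp : p₀ with
      | vertex v =>
        have := hall v
        rw [hm, hp] at this
        exact absurd this (lt_irrefl _)
      | inner e t ht => exact ⟨e, t, ht, rfl⟩
    have htm : f (Γ.edgePoint e t) = m := by rw [edgePoint_inner e ht, hm, hp]
    have htI : t ∈ Icc 0 (Γ.len e) := ⟨ht.1.le, ht.2.le⟩
    obtain ⟨t₁, h1, h2, h3, h4⟩ := hfirst e t htI htm (hall _)
    obtain ⟨t₂, h5, h6, h7, h8⟩ := hlast e t htI htm (hall _)
    have ht₁ : 0 < t₁ ∧ t₁ < Γ.len e := ⟨h1, h2.trans_lt ht.2⟩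
    have ht₂ : 0 < t₂ ∧ t₂ < Γ.len e := ⟨ht.1.trans_le h5, h6⟩
    have c1 := hchip e t₁ ht₁
    have c2 := hchip e t₂ ht₂
    have r1 := hR e t₁ ht₁.1.le ht₁.2 h3
    have l2 := hL e t₂ ht₂.1 ht₂.2.le h7
    obtain ⟨t₀, hone⟩ := hone e
    have e1 : t₁ = t₀ := by
      by_contra hne
      have : (D (Point.inner e t₁ ht₁) : ℝ) ≤ 0 := by exact_mod_cast (hone t₁ ht₁).2 hne
      linarith
    have e2 : t₂ = t₀ := by
      by_contra hne
      have : (D (Point.inner e t₂ ht₂) : ℝ) ≤ 0 := by exact_mod_cast (hone t₂ ht₂).2 hne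
      linarith
    subst e1
    subst e2
    have : (D (Point.inner e t₂ ht₂) : ℝ) ≤ 1 := by exact_mod_cast (hone t₂ ht₂).1
    linarith
  · have h1 := (hord' _).trans (hvert v hv A hA)
    have h2 : (A.card : ℝ) ≤ D (Point.vertex v) := by linarith
    exact_mod_cast h2

end MetricGraph

/-! ### A burning criterion for three chips -/

namespace MetricGraph

variable {Γ : MetricGraph}

/-- The point `p` lies in the interior of the edge `e`. -/
def Point.InteriorTo (p : Γ.Point) (e : Γ.E) : Prop := ∃ t ht, p = Point.inner e t ht

/-- The edge `e` joins `u` to `v`. -/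
def Joins (e : Γ.E) (u v : Γ.V) : Prop :=
  (Γ.src e = u ∧ Γ.tgt e = v) ∨ (Γ.src e = v ∧ Γ.tgt e = u)

theorem Joins.symm {e : Γ.E} {u v : Γ.V} (h : Joins e u v) : Joins e v u := Or.symm h

theorem edgePoint_interiorTo_iff {e e' : Γ.E} {t : ℝ} (h0 : 0 < t) (h1 : t < Γ.len e) :
    (Γ.edgePoint e t).InteriorTo e' ↔ e = e' := by
  rw [edgePoint_inner e ⟨h0, h1⟩]
  constructor
  · rintro ⟨t', ht', h⟩
    injection h
  · rintro rfl
    exact ⟨t, ⟨h0, h1⟩, rfl⟩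

theorem not_vertex_interiorTo (v : Γ.V) (e : Γ.E) :
    ¬ (Point.vertex v : Γ.Point).InteriorTo e := by
  rintro ⟨t, ht, h⟩
  cases h

theorem edgePoint_ne_vertex {e : Γ.E} {t : ℝ} (h0 : 0 < t) (h1 : t < Γ.len e) (v : Γ.V) :
    Γ.edgePoint e t ≠ Point.vertex v := by
  rw [edgePoint_inner e ⟨h0, h1⟩]
  exact fun h => by cases h

open Classical in
theorem triple_apply (p q r x : Γ.Point) : triple p q r x =
    (if p = x then 1 else 0) + (if q = x then 1 else 0) + (if r = x then 1 else 0) := by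
  simp only [triple, Finsupp.add_apply, Finsupp.single_apply]

theorem triple_apply_inner_le {p q r : Γ.Point} {e : Γ.E} (hp : ¬ p.InteriorTo e)
    (hq : ¬ q.InteriorTo e) (t : ℝ) (ht : 0 < t ∧ t < Γ.len e) :
    triple p q r (Point.inner e t ht) ≤ 1 ∧
      (∀ s hs, r = Point.inner e s hs → t ≠ s → triple p q r (Point.inner e t ht) ≤ 0) ∧
      (¬ r.InteriorTo e → triple p q r (Point.inner e t ht) ≤ 0) := by
  rw [triple_apply, if_neg fun h => hp ⟨t, ht, h⟩, if_neg fun h => hq ⟨t, ht, h⟩]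
  refine ⟨by split_ifs <;> simp, ?_, fun hr => by rw [if_neg fun h => hr ⟨t, ht, h⟩]; simp⟩
  rintro s hs rfl hts
  rw [if_neg]
  · simp
  · intro h
    injection h with _ h
    exact hts h.symm

/-- A criterion for a divisor of degree three to have rank less than one. -/
theorem not_rankAtLeast_one {p q r : Γ.Point} (hpq : ∀ e, p.InteriorTo e → ¬ q.InteriorTo e)
    (hpr : ∀ e, p.InteriorTo e → ¬ r.InteriorTo e) (hqr : ∀ e, q.InteriorTo e → ¬ r.InteriorTo e)
    (x : Γ.V) (hx : triple p q r (Point.vertex x) ≤ 0)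
    (hburn : ∀ B : Γ.V → Prop, B x →
      (∀ u v e, Joins e u v → ¬ p.InteriorTo e → ¬ q.InteriorTo e → ¬ r.InteriorTo e →
        triple p q r (Point.vertex v) ≤ 0 → B u → B v) →
      (∀ u u' v e e', e ≠ e' → Joins e u v → Joins e' u' v → ¬ p.InteriorTo e →
        ¬ q.InteriorTo e → ¬ r.InteriorTo e → ¬ p.InteriorTo e' →
        ¬ q.InteriorTo e' → ¬ r.InteriorTo e' →
        triple p q r (Point.vertex v) ≤ 1 → B u → B u' → B v) → ∀ v, B v) :
    ¬ Γ.RankAtLeast (triple p q r) 1 := by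
  classical
  intro hrank
  obtain ⟨D', hD', h0, h1⟩ := hrank.exists_single_le (Point.vertex x)
  have hfree : ∀ e, ¬ p.InteriorTo e → ¬ q.InteriorTo e → ¬ r.InteriorTo e → ∀ t ht,
      triple p q r (Point.inner e t ht) ≤ 0 := fun e hp hq hr t ht =>
    (triple_apply_inner_le hp hq t ht).2.2 hr
  have hone : ∀ p q r : Γ.Point, ∀ e, ¬ p.InteriorTo e → ¬ q.InteriorTo e → ∃ t₀, ∀ t ht,
      triple p q r (Point.inner e t ht) ≤ 1 ∧
        (t ≠ t₀ → triple p q r (Point.inner e t ht) ≤ 0) := by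
    intro p q r e hp hq
    by_cases hr : r.InteriorTo e
    · obtain ⟨s, hs, h⟩ := hr
      exact ⟨s, fun t ht => ⟨(triple_apply_inner_le hp hq t ht).1,
        (triple_apply_inner_le hp hq t ht).2.1 s hs h⟩⟩
    · exact ⟨0, fun t ht => ⟨(triple_apply_inner_le hp hq t ht).1,
        fun _ => (triple_apply_inner_le hp hq t ht).2.2 hr⟩⟩
  -- At most one of the three points is interior to `e`; the triple is reordered so that this one
  -- comes last, as `hone` expects.
  obtain ⟨B, hBx, ⟨v, hv⟩, hB⟩ := exists_burnt_set hD' h0 hx h1 fun e => by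
    by_cases hp : p.InteriorTo e
    · rw [triple_reverse]
      exact hone r q p e (hpr e hp) (hpq e hp)
    by_cases hq : q.InteriorTo e
    · rw [triple_swap_right]
      exact hone p r q e hp (hqr e hq)
    · exact hone p q r e hp hq
  refine hv (hburn B hBx ?_ ?_ v)
  · intro u v e he hp hq hr hc hu
    by_contra hv
    have := hB v hv {e} (by
      intro e' he'
      rw [Finset.mem_singleton.mp he']
      refine ⟨hfree e hp hq hr, ?_⟩
      rcases he with ⟨h, h'⟩ | ⟨h, h'⟩
      · exact Or.inr ⟨h', h ▸ hu⟩
      · exact Or.inl ⟨h, h' ▸ hu⟩)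
    rw [Finset.card_singleton] at this
    push_cast at this
    omega
  · intro u u' v e e' hne he he' hp hq hr hp' hq' hr' hc hu hu'
    by_contra hv
    have := hB v hv {e, e'} (by
      intro e'' he''
      rcases Finset.mem_insert.mp he'' with rfl | he''
      · refine ⟨hfree _ hp hq hr, ?_⟩
        rcases he with ⟨h, h'⟩ | ⟨h, h'⟩
        · exact Or.inr ⟨h', h ▸ hu⟩
        · exact Or.inl ⟨h, h' ▸ hu⟩
      · rw [Finset.mem_singleton.mp he'']
        refine ⟨hfree _ hp' hq' hr', ?_⟩
        rcases he' with ⟨h, h'⟩ | ⟨h, h'⟩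
        · exact Or.inr ⟨h', h ▸ hu'⟩
        · exact Or.inl ⟨h, h' ▸ hu'⟩)
    rw [Finset.card_pair hne] at this
    push_cast at this
    omega

end MetricGraph

/-! ### Burning a loop of loops -/

namespace LoopOfLoops

open MetricGraph

variable (Γ : LoopOfLoops 4)

theorem joins_spoke (i : Fin (4 - 1)) :
    Joins (Γ := Γ.toMetricGraph) (Sum.inl i) (Sum.inl i) (Sum.inr i) := Or.inl ⟨rfl, rfl⟩

theorem joins_arc {i j : Fin (4 - 1)} (hj : next i = j) (ε : Fin 2) :
    Joins (Γ := Γ.toMetricGraph) (Sum.inr (i, ε)) (Sum.inr i) (Sum.inl j) :=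
  Or.inl ⟨rfl, congrArg Sum.inl hj⟩

/-- The burning criterion for a loop of loops: fire spreads along the edges satisfying `F` to the
vertices satisfying `N₀`, and from two sides also to those satisfying `N₁`. -/
theorem not_rankAtLeast_one_of_burning {p q r : Γ.toMetricGraph.Point}
    (hpq : ∀ e, p.InteriorTo e → ¬ q.InteriorTo e) (hpr : ∀ e, p.InteriorTo e → ¬ r.InteriorTo e)
    (hqr : ∀ e, q.InteriorTo e → ¬ r.InteriorTo e)
    (F : Fin (4 - 1) ⊕ (Fin (4 - 1) × Fin 2) → Prop) (N₀ N₁ : Fin (4 - 1) ⊕ Fin (4 - 1) → Prop)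
    (hF : ∀ e, F e → ¬ p.InteriorTo e ∧ ¬ q.InteriorTo e ∧ ¬ r.InteriorTo e)
    (h₀ : ∀ v, N₀ v → triple p q r (Point.vertex v) ≤ 0)
    (h₁ : ∀ v, N₁ v → triple p q r (Point.vertex v) ≤ 1)
    (x : Fin (4 - 1) ⊕ Fin (4 - 1)) (hx : N₀ x)
    (hburn : ∀ B : Fin (4 - 1) ⊕ Fin (4 - 1) → Prop, B x →
      (∀ l, F (Sum.inl l) → N₀ (Sum.inr l) → B (Sum.inl l) → B (Sum.inr l)) →
      (∀ l, F (Sum.inl l) → N₀ (Sum.inl l) → B (Sum.inr l) → B (Sum.inl l)) →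
      (∀ l ε, F (Sum.inr (l, ε)) → N₀ (Sum.inl (next l)) →
        B (Sum.inr l) → B (Sum.inl (next l))) →
      (∀ l ε, F (Sum.inr (l, ε)) → N₀ (Sum.inr l) → B (Sum.inl (next l)) → B (Sum.inr l)) →
      (∀ l ε, F (Sum.inl l) → F (Sum.inr (l, ε)) → N₁ (Sum.inr l) → B (Sum.inl l) →
        B (Sum.inl (next l)) → B (Sum.inr l)) →
      (∀ l ε, F (Sum.inl (next l)) → F (Sum.inr (l, ε)) → N₁ (Sum.inl (next l)) → B (Sum.inr l) →
        B (Sum.inr (next l)) → B (Sum.inl (next l))) →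
      (∀ l, F (Sum.inr (l, 0)) → F (Sum.inr (l, 1)) → N₁ (Sum.inl (next l)) → B (Sum.inr l) →
        B (Sum.inl (next l))) →
      (∀ l, F (Sum.inr (l, 0)) → F (Sum.inr (l, 1)) → N₁ (Sum.inr l) → B (Sum.inl (next l)) →
        B (Sum.inr l)) → ∀ v, B v) :
    ¬ Γ.toMetricGraph.RankAtLeast (triple p q r) 1 := by
  refine not_rankAtLeast_one hpq hpr hqr x (h₀ x hx) fun B hB R₁ R₂ => ?_
  have S₁ : ∀ {u v} e, Joins e u v → F e → N₀ v → B u → B v := fun {u v} e he hf hv =>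
    R₁ u v e he (hF e hf).1 (hF e hf).2.1 (hF e hf).2.2 (h₀ v hv)
  have S₂ : ∀ {u u' v} e e', e ≠ e' → Joins e u v → Joins e' u' v → F e → F e' → N₁ v →
      B u → B u' → B v := fun {u u' v} e e' hne he he' hf hf' hv =>
    R₂ u u' v e e' hne he he' (hF e hf).1 (hF e hf).2.1 (hF e hf).2.2 (hF e' hf').1
      (hF e' hf').2.1 (hF e' hf').2.2 (h₁ v hv)
  refine hburn B hB (fun l => S₁ _ (Γ.joins_spoke l)) (fun l => S₁ _ (Γ.joins_spoke l).symm)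
    (fun l ε => S₁ _ (Γ.joins_arc rfl ε)) (fun l ε => S₁ _ (Γ.joins_arc rfl ε).symm)
    (fun l ε => S₂ _ _ Sum.inl_ne_inr (Γ.joins_spoke l) (Γ.joins_arc rfl ε).symm)
    (fun l ε hf hf' hv h h' => S₂ _ _ Sum.inl_ne_inr (Γ.joins_spoke _).symm (Γ.joins_arc rfl ε)
      hf hf' hv h' h) (fun l hf hf' hv h => S₂ _ _ ?_ (Γ.joins_arc rfl 0) (Γ.joins_arc rfl 1)
      hf hf' hv h h) (fun l hf hf' hv h => S₂ _ _ ?_ (Γ.joins_arc rfl 0).symm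
      (Γ.joins_arc rfl 1).symm hf hf' hv h h)
  all_goals exact fun h => by injection h with h; injection h with _ h; exact absurd h (by decide)

theorem forall_vertex {P : Fin (4 - 1) ⊕ Fin (4 - 1) → Prop} {i j k : Fin (4 - 1)}
    (hj : next i = j) (hk : next j = k) (h₁ : P (Sum.inl i)) (h₂ : P (Sum.inl j))
    (h₃ : P (Sum.inl k)) (h₄ : P (Sum.inr i)) (h₅ : P (Sum.inr j)) (h₆ : P (Sum.inr k)) :
    ∀ v, P v := by
  have hall : ∀ l, l = i ∨ l = j ∨ l = k := fun l => by
    have := eq_or_eq_next i l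
    rwa [hj, hk] at this
  rintro (l | l) <;> rcases hall l with rfl | rfl | rfl <;> assumption

theorem next_ne : ∀ i, next i ≠ i := by decide

theorem next_next_ne : ∀ i, next (next i) ≠ i := by decide

theorem inl_ne_inl {i j : Fin (4 - 1)} (h : i ≠ j) :
    (Sum.inl i : Fin (4 - 1) ⊕ Fin (4 - 1)) ≠ Sum.inl j := fun h' => h (Sum.inl.inj h')

theorem inr_ne_inr {i j : Fin (4 - 1)} (h : i ≠ j) :
    (Sum.inr i : Fin (4 - 1) ⊕ Fin (4 - 1)) ≠ Sum.inr j := fun h' => h (Sum.inr.inj h')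

/-- Fire spreads around a hexagon with a single chip at one of its vertices. -/
theorem hexagon_burns (x : Fin (4 - 1) ⊕ Fin (4 - 1)) :
    ∃ y ≠ x, ∀ B : Fin (4 - 1) ⊕ Fin (4 - 1) → Prop, B y →
      (∀ l, Sum.inr l ≠ x → B (Sum.inl l) → B (Sum.inr l)) →
      (∀ l, Sum.inl l ≠ x → B (Sum.inr l) → B (Sum.inl l)) →
      (∀ l, Sum.inl (next l) ≠ x → B (Sum.inr l) → B (Sum.inl (next l))) →
      (∀ l, Sum.inr l ≠ x → B (Sum.inl (next l)) → B (Sum.inr l)) →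
      (∀ l, B (Sum.inl l) → B (Sum.inl (next l)) → B (Sum.inr l)) →
      (∀ l, B (Sum.inr l) → B (Sum.inr (next l)) → B (Sum.inl (next l))) → ∀ v, B v := by
  -- The fire starts at a neighbour of `x` and runs round the hexagon away from `x`, which is met
  -- last, from both sides.
  rcases x with l | l
  · refine ⟨Sum.inr l, Sum.inr_ne_inl, fun B h A₁ _ A₃ _ _ A₆ => ?_⟩
    have h₁ := A₃ l (inl_ne_inl (next_ne l)) h
    have h₂ := A₁ _ Sum.inr_ne_inl h₁
    have h₃ := A₃ _ (inl_ne_inl (next_next_ne l)) h₂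
    have h₄ := A₁ _ Sum.inr_ne_inl h₃
    have h₅ := A₆ _ h₄ (by rwa [next_next_next])
    rw [next_next_next] at h₅
    exact forall_vertex rfl rfl h₅ h₁ h₃ h h₂ h₄
  · refine ⟨Sum.inl l, Sum.inl_ne_inr, fun B h _ A₂ _ A₄ A₅ _ => ?_⟩
    have h₁ := A₄ _ (inr_ne_inr (next_next_ne l)) (by rwa [next_next_next])
    have h₂ := A₂ _ Sum.inl_ne_inr h₁
    have h₃ := A₄ _ (inr_ne_inr (next_ne l)) h₂
    have h₄ := A₂ _ Sum.inl_ne_inr h₃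
    have h₅ := A₅ _ h h₄
    exact forall_vertex rfl rfl h h₄ h₂ h₅ h₃ h₁

/-- Fire spreads around a hexagon with a gap. -/
theorem hexagon_burns_of_edge (e : Fin (4 - 1) ⊕ (Fin (4 - 1) × Fin 2)) :
    ∃ y, ∀ B : Fin (4 - 1) ⊕ Fin (4 - 1) → Prop, B y →
      (∀ l, e ≠ Sum.inl l → B (Sum.inl l) → B (Sum.inr l)) →
      (∀ l, (∀ ε, e ≠ Sum.inr (l, ε)) → B (Sum.inr l) → B (Sum.inl (next l))) → ∀ v, B v := by
  -- The fire starts just beyond the gap and runs once round, so no vertex has to burn against the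
  -- orientation.
  rcases e with l | ⟨l, ε⟩
  · refine ⟨Sum.inr l, fun B h A₁ A₂ => ?_⟩
    have hne : ∀ {l'}, l ≠ l' →
        (Sum.inl l : Fin (4 - 1) ⊕ (Fin (4 - 1) × Fin 2)) ≠ Sum.inl l' :=
      fun h h' => h (Sum.inl.inj h')
    have h₁ := A₂ l (fun _ => Sum.inl_ne_inr) h
    have h₂ := A₁ _ (hne (next_ne l).symm) h₁
    have h₃ := A₂ _ (fun _ => Sum.inl_ne_inr) h₂
    have h₄ := A₁ _ (hne (next_next_ne l).symm) h₃
    have h₅ := A₂ _ (fun _ => Sum.inl_ne_inr) h₄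
    rw [next_next_next] at h₅
    exact forall_vertex rfl rfl h₅ h₁ h₃ h h₂ h₄
  · refine ⟨Sum.inl (next l), fun B h A₁ A₂ => ?_⟩
    have hne : ∀ {l'}, l ≠ l' → ∀ ε',
        (Sum.inr (l, ε) : Fin (4 - 1) ⊕ (Fin (4 - 1) × Fin 2)) ≠ Sum.inr (l', ε') :=
      fun h _ h' => h (Prod.mk.inj (Sum.inr.inj h')).1
    have h₁ := A₁ _ Sum.inr_ne_inl h
    have h₂ := A₂ _ (hne (next_ne l).symm) h₁
    have h₃ := A₁ _ Sum.inr_ne_inl h₂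
    have h₄ := A₂ _ (hne (next_next_ne l).symm) h₃
    rw [next_next_next] at h₄
    have h₅ := A₁ _ Sum.inr_ne_inl h₄
    exact forall_vertex rfl rfl h₄ h h₂ h₅ h₁ h₃

section

variable {Γ} {i j k : Fin (4 - 1)} {s t u : ℝ}

theorem arc_zero_interiorTo_iff (hs : 0 < s ∧ s < Γ.double i 0) (e) :
    (Γ.arc i 0 s).InteriorTo e ↔ Sum.inr (i, 0) = e := edgePoint_interiorTo_iff hs.1 hs.2

theorem arc_ne_vertex {ε : Fin 2} (hs : 0 < s ∧ s < Γ.double i ε) (v) :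
    Γ.arc i ε s ≠ Point.vertex v := edgePoint_ne_vertex hs.1 hs.2 v

theorem spoke_ne_vertex (hs : 0 < s ∧ s < Γ.single i) (v) :
    Γ.spoke i s ≠ Point.vertex v := edgePoint_ne_vertex hs.1 hs.2 v

theorem inr_zero_ne_inl (i l : Fin (4 - 1)) :
    (Sum.inr (i, 0) : Fin (4 - 1) ⊕ (Fin (4 - 1) × Fin 2)) ≠ Sum.inl l := Sum.inr_ne_inl

theorem inr_zero_ne_inr_one (i l : Fin (4 - 1)) :
    (Sum.inr (i, 0) : Fin (4 - 1) ⊕ (Fin (4 - 1) × Fin 2)) ≠ Sum.inr (l, 1) := by simp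

theorem not_both_arcs (hij : i ≠ j) (hs : 0 < s ∧ s < Γ.double i 0)
    (ht : 0 < t ∧ t < Γ.double j 0) (e) :
    (Γ.arc i 0 s).InteriorTo e → ¬ (Γ.arc j 0 t).InteriorTo e := by
  rw [arc_zero_interiorTo_iff hs, arc_zero_interiorTo_iff ht]
  exact fun h h' => hij (Prod.mk.inj (Sum.inr.inj (h.trans h'.symm))).1

/-- The two chips inside loops lie on edges of index 0, so the spokes and the edges of index 1 form
a hexagon through all vertices whose only chip is at `x`. -/
theorem not_rank_of_two_arcs_of_vertex (hij : i ≠ j) (hs : 0 < s ∧ s < Γ.double i 0)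
    (ht : 0 < t ∧ t < Γ.double j 0) (x : Fin (4 - 1) ⊕ Fin (4 - 1)) :
    ¬ Γ.toMetricGraph.RankAtLeast (triple (Γ.arc i 0 s) (Γ.arc j 0 t) (Point.vertex x)) 1 := by
  have hr := not_vertex_interiorTo (Γ := Γ.toMetricGraph) x
  obtain ⟨y, hy, hB⟩ := hexagon_burns x
  refine Γ.not_rankAtLeast_one_of_burning (not_both_arcs hij hs ht) (fun e _ => hr e)
    (fun e _ => hr e) (fun e => Sum.inr (i, 0) ≠ e ∧ Sum.inr (j, 0) ≠ e) (· ≠ x) (fun _ => True)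
    (fun e he => ⟨fun h => he.1 ((arc_zero_interiorTo_iff hs e).mp h),
      fun h => he.2 ((arc_zero_interiorTo_iff ht e).mp h), hr e⟩)
    (fun v hv => ?_) (fun v _ => ?_) y hy fun B hBy A₁ A₂ A₃ A₄ A₅ A₆ _ _ => ?_
  · rw [triple_apply, if_neg (arc_ne_vertex hs v), if_neg (arc_ne_vertex ht v), if_neg]
    · simp
    · intro h
      injection h with h
      exact hv h.symm
  · rw [triple_apply, if_neg (arc_ne_vertex hs v), if_neg (arc_ne_vertex ht v)]
    split_ifs <;> simp
  · have Fs := fun l => And.intro (inr_zero_ne_inl i l) (inr_zero_ne_inl j l)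
    have Fa := fun l => And.intro (inr_zero_ne_inr_one i l) (inr_zero_ne_inr_one j l)
    exact hB B hBy (fun l => A₁ l (Fs l)) (fun l => A₂ l (Fs l)) (fun l => A₃ l 1 (Fa l))
      (fun l => A₄ l 1 (Fa l)) (fun l => A₅ l 1 (Fs l) (Fa l) trivial)
      (fun l => A₆ l 1 (Fs _) (Fa l) trivial)

/-- The third chip interrupts the hexagon of spokes and edges of index 1 at most once, and no vertex
carries a chip. -/
theorem not_rank_of_two_arcs_of_edge (hij : i ≠ j) (hs : 0 < s ∧ s < Γ.double i 0)
    (ht : 0 < t ∧ t < Γ.double j 0) {e : Fin (4 - 1) ⊕ (Fin (4 - 1) × Fin 2)}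
    (hi : Sum.inr (i, 0) ≠ e) (hj : Sum.inr (j, 0) ≠ e) (hu) :
    ¬ Γ.toMetricGraph.RankAtLeast
      (triple (Γ.arc i 0 s) (Γ.arc j 0 t) (Point.inner e u hu)) 1 := by
  have hr : ∀ e', (Point.inner e u hu : Γ.toMetricGraph.Point).InteriorTo e' → e = e' := by
    rintro e' ⟨_, _, h⟩
    injection h
  obtain ⟨y, hB⟩ := hexagon_burns_of_edge e
  refine Γ.not_rankAtLeast_one_of_burning (not_both_arcs hij hs ht) (fun e' h h' => ?_)
    (fun e' h h' => ?_) (fun e' => Sum.inr (i, 0) ≠ e' ∧ Sum.inr (j, 0) ≠ e' ∧ e ≠ e')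
    (fun _ => True) (fun _ => True)
    (fun e he => ⟨fun h => he.1 ((arc_zero_interiorTo_iff hs e).mp h),
      fun h => he.2.1 ((arc_zero_interiorTo_iff ht e).mp h), fun h => he.2.2 (hr e h)⟩)
    (fun v _ => ?_) (fun v _ => ?_) y trivial fun B hBy A₁ A₂ A₃ _ _ _ _ _ => ?_
  · exact hi (((arc_zero_interiorTo_iff hs e').mp h).trans (hr e' h').symm)
  · exact hj (((arc_zero_interiorTo_iff ht e').mp h).trans (hr e' h').symm)
  · rw [triple_apply, if_neg (arc_ne_vertex hs v), if_neg (arc_ne_vertex ht v), if_neg nofun]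
    simp
  · rw [triple_apply, if_neg (arc_ne_vertex hs v), if_neg (arc_ne_vertex ht v), if_neg nofun]
    simp
  · exact hB B hBy (fun l h => A₁ l ⟨inr_zero_ne_inl i l, inr_zero_ne_inl j l, h⟩ trivial)
      (fun l h => A₃ l 1 ⟨inr_zero_ne_inr_one i l, inr_zero_ne_inr_one j l, h 1⟩ trivial)

end

end LoopOfLoops

/-! ### Two points that no divisor of degree three and rank one contains -/

namespace LoopOfLoops

open MetricGraph

variable {Γ : LoopOfLoops 4} {i j k : Fin (4 - 1)} {s t : ℝ}

theorem spoke_interiorTo_iff (hs : 0 < s ∧ s < Γ.single j) (e) :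
    (Γ.spoke j s).InteriorTo e ↔ Sum.inl j = e := edgePoint_interiorTo_iff hs.1 hs.2

theorem not_both_spoke_arc (hs : 0 < s ∧ s < Γ.single j) (ht : 0 < t ∧ t < Γ.double i 0) (e) :
    (Γ.spoke j s).InteriorTo e → ¬ (Γ.arc i 0 t).InteriorTo e := by
  rw [spoke_interiorTo_iff hs, arc_zero_interiorTo_iff ht]
  exact fun h h' => Sum.inl_ne_inr (h.trans h'.symm)

theorem triple_vertex_spoke_arc_apply (hs : 0 < s ∧ s < Γ.single j)
    (ht : 0 < t ∧ t < Γ.double i 0) (x v : Fin (4 - 1) ⊕ Fin (4 - 1)) :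
    triple (Point.vertex x) (Γ.spoke j s) (Γ.arc i 0 t) (Point.vertex v) =
      if x = v then 1 else 0 := by
  rw [triple_apply, if_neg (spoke_ne_vertex hs v), if_neg (arc_ne_vertex ht v)]
  simp only [add_zero]
  congr 1
  exact propext ⟨fun h => by injection h, fun h => h ▸ rfl⟩

theorem triple_vertex_vertex_arc_apply (ht : 0 < t ∧ t < Γ.double i 0)
    (x y v : Fin (4 - 1) ⊕ Fin (4 - 1)) :
    triple (Point.vertex x) (Point.vertex y) (Γ.arc i 0 t) (Point.vertex v) =
      (if x = v then 1 else 0) + if y = v then 1 else 0 := by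
  rw [triple_apply, if_neg (arc_ne_vertex ht v), add_zero]
  congr 2
  all_goals exact propext ⟨fun h => by injection h, fun h => h ▸ rfl⟩

/-- A fire at `w k` attacks `v i` along both edges of loop k, and the single chip there cannot stop
it. It goes on to `w i` and `v j`, and on the other side through `v k` to `w j`. If `s` is the full
length of spoke j, the chip at `w j` is attacked from both `v j` and `v k`. -/
theorem not_rank_of_v_spoke_arc (hi : next k = i) (hj : next i = j) (hk : next j = k)
    (hs : 0 < s ∧ s ≤ Γ.single j) (ht : 0 < t ∧ t < Γ.double j 0) :
    ¬ Γ.toMetricGraph.RankAtLeast (triple (Γ.v i) (Γ.spoke j s) (Γ.arc j 0 t)) 1 := by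
  have hij : i ≠ j := hj ▸ ne_next i
  have hjk : j ≠ k := hk ▸ ne_next j
  have hki : k ≠ i := hi ▸ ne_next k
  have hv := not_vertex_interiorTo (Γ := Γ.toMetricGraph)
  rcases hs.2.lt_or_eq with hlt | rfl
  · have hs : 0 < s ∧ s < Γ.single j := ⟨hs.1, hlt⟩
    refine Γ.not_rankAtLeast_one_of_burning (fun e h => absurd h (hv _ e))
      (fun e h => absurd h (hv _ e)) (not_both_spoke_arc hs ht)
      (fun e => Sum.inl j ≠ e ∧ Sum.inr (j, 0) ≠ e) (Sum.inl i ≠ ·) (fun _ => True)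
      (fun e he => ⟨hv _ e, fun h => he.1 ((spoke_interiorTo_iff hs e).mp h),
        fun h => he.2 ((arc_zero_interiorTo_iff ht e).mp h)⟩) (fun v hv => ?_) (fun v _ => ?_)
      (Sum.inr k) Sum.inl_ne_inr fun B h A₁ A₂ A₃ A₄ _ _ A₇ _ => ?_
    · rw [triple_vertex_spoke_arc_apply hs ht, if_neg hv]
    · rw [triple_vertex_spoke_arc_apply hs ht]
      split_ifs <;> simp
    · have h₁ := A₇ k (by simp [hjk]) (by simp [hjk]) trivial h
      rw [hi] at h₁
      have h₂ := A₂ k (by simp [hjk]) (by simp [hki.symm]) h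
      have h₃ := A₁ i (by simp [hij.symm]) (by simp) h₁
      have h₄ := A₃ i 1 (by simp) (by simp [hj, hij]) h₃
      have h₅ := A₄ j 1 (by simp) (by simp) (by rwa [hk])
      rw [hj] at h₄
      exact forall_vertex hj hk h₁ h₄ h₂ h₃ h₅ h
  · rw [spoke_single]
    refine Γ.not_rankAtLeast_one_of_burning (fun e h => absurd h (hv _ e))
      (fun e h => absurd h (hv _ e)) (fun e h => absurd h (hv _ e))
      (fun e => Sum.inr (j, 0) ≠ e) (fun v => Sum.inl i ≠ v ∧ Sum.inr j ≠ v) (fun _ => True)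
      (fun e he => ⟨hv _ e, hv _ e, fun h => he ((arc_zero_interiorTo_iff ht e).mp h)⟩)
      (fun v hv => ?_) (fun v _ => ?_)
      (Sum.inr k) ⟨Sum.inl_ne_inr, inr_ne_inr hjk⟩ fun B h A₁ A₂ A₃ A₄ A₅ _ A₇ _ => ?_
    · rw [triple_vertex_vertex_arc_apply ht, if_neg hv.1, if_neg hv.2, add_zero]
    · rw [triple_vertex_vertex_arc_apply ht]
      split_ifs with h h'
      · exact absurd (h.trans h'.symm) Sum.inl_ne_inr
      all_goals simp
    · have h₁ := A₇ k (by simp [hjk]) (by simp [hjk]) trivial h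
      rw [hi] at h₁
      have h₂ := A₂ k (by simp) (by simp [hki.symm]) h
      have h₃ := A₁ i (by simp) (by simp [hij.symm]) h₁
      have h₄ := A₃ i 1 (by simp) (by simp [hj, hij]) h₃
      rw [hj] at h₄
      have h₅ := A₅ j 1 (by simp) (by simp) trivial h₄ (by rwa [hk])
      exact forall_vertex hj hk h₁ h₄ h₂ h₃ h₅ h

/-- The mirror image: a fire at `v i` burns through `w k` along both edges of loop k. If `s` is
zero, the chip at `v j` is attacked from both `w i` and `w j`. -/
theorem not_rank_of_w_spoke_arc (hi : next k = i) (hj : next i = j) (hk : next j = k)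
    (hs : 0 ≤ s ∧ s < Γ.single j) (ht : 0 < t ∧ t < Γ.double i 0) :
    ¬ Γ.toMetricGraph.RankAtLeast (triple (Γ.w k) (Γ.spoke j s) (Γ.arc i 0 t)) 1 := by
  have hij : i ≠ j := hj ▸ ne_next i
  have hjk : j ≠ k := hk ▸ ne_next j
  have hki : k ≠ i := hi ▸ ne_next k
  have hv := not_vertex_interiorTo (Γ := Γ.toMetricGraph)
  rcases hs.1.lt_or_eq with hlt | rfl
  · have hs : 0 < s ∧ s < Γ.single j := ⟨hlt, hs.2⟩
    refine Γ.not_rankAtLeast_one_of_burning (fun e h => absurd h (hv _ e))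
      (fun e h => absurd h (hv _ e)) (not_both_spoke_arc hs ht)
      (fun e => Sum.inl j ≠ e ∧ Sum.inr (i, 0) ≠ e) (Sum.inr k ≠ ·) (fun _ => True)
      (fun e he => ⟨hv _ e, fun h => he.1 ((spoke_interiorTo_iff hs e).mp h),
        fun h => he.2 ((arc_zero_interiorTo_iff ht e).mp h)⟩) (fun v hv => ?_) (fun v _ => ?_)
      (Sum.inl i) Sum.inr_ne_inl fun B h A₁ A₂ A₃ A₄ _ _ _ A₈ => ?_
    · rw [triple_vertex_spoke_arc_apply hs ht, if_neg hv]
    · rw [triple_vertex_spoke_arc_apply hs ht]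
      split_ifs <;> simp
    · have h₁ := A₈ k (by simp [hki.symm]) (by simp [hki.symm]) trivial (by rwa [hi])
      have h₂ := A₂ k (by simp [hjk]) (by simp) h₁
      have h₃ := A₁ i (by simp [hij.symm]) (by simp [hki]) h
      have h₄ := A₃ i 1 (by simp) (by simp) h₃
      have h₅ := A₄ j 1 (by simp) (by simp [hjk.symm]) (by rwa [hk])
      rw [hj] at h₄
      exact forall_vertex hj hk h h₄ h₂ h₃ h₅ h₁
  · rw [spoke_zero]
    refine Γ.not_rankAtLeast_one_of_burning (fun e h => absurd h (hv _ e))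
      (fun e h => absurd h (hv _ e)) (fun e h => absurd h (hv _ e))
      (fun e => Sum.inr (i, 0) ≠ e) (fun v => Sum.inr k ≠ v ∧ Sum.inl j ≠ v) (fun _ => True)
      (fun e he => ⟨hv _ e, hv _ e, fun h => he ((arc_zero_interiorTo_iff ht e).mp h)⟩)
      (fun v hv => ?_) (fun v _ => ?_)
      (Sum.inl i) ⟨Sum.inr_ne_inl, inl_ne_inl hij.symm⟩ fun B h A₁ A₂ A₃ A₄ _ A₆ _ A₈ => ?_
    · rw [triple_vertex_vertex_arc_apply ht, if_neg hv.1, if_neg hv.2, add_zero]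
    · rw [triple_vertex_vertex_arc_apply ht]
      split_ifs with h h'
      · exact absurd (h.trans h'.symm) Sum.inr_ne_inl
      all_goals simp
    · have h₁ := A₈ k (by simp [hki.symm]) (by simp [hki.symm]) trivial (by rwa [hi])
      have h₂ := A₂ k (by simp) (by simp [hjk]) h₁
      have h₃ := A₁ i (by simp) (by simp [hki]) h
      have h₅ := A₄ j 1 (by simp) (by simp [hjk.symm]) (by rwa [hk])
      have h₄ := A₆ i 1 (by simp) (by simp) trivial h₃ (by rwa [hj])
      rw [hj] at h₄
      exact forall_vertex hj hk h h₄ h₂ h₃ h₅ h₁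

/-- Two points inside loops that are separated by a longest spoke do not lie in a common divisor
of degree three and rank one. -/
theorem not_rank_of_two_arcs (hi : next k = i) (hj : next i = j) (hk : next j = k)
    (hij' : Γ.single i ≤ Γ.single j) (hkj : Γ.single k ≤ Γ.single j)
    (hs : 0 < s ∧ s < Γ.double i 0) (ht : 0 < t ∧ t < Γ.double j 0) (x : Γ.toMetricGraph.Point) :
    ¬ Γ.toMetricGraph.RankAtLeast (triple (Γ.arc i 0 s) (Γ.arc j 0 t) x) 1 := by
  have hij : i ≠ j := hj ▸ ne_next i
  have hjk : j ≠ k := hk ▸ ne_next j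
  have ci := Γ.single_pos i
  have cj := Γ.single_pos j
  have ck := Γ.single_pos k
  obtain ⟨hs0, hs1⟩ := hs
  obtain ⟨ht0, ht1⟩ := ht
  cases x with
  | vertex x => exact not_rank_of_two_arcs_of_vertex hij ⟨hs0, hs1⟩ ⟨ht0, ht1⟩ x
  | inner e u hu =>
    by_cases hei : Sum.inr (i, 0) = e
    · rw [← edgePoint_inner]
      subst hei
      obtain ⟨hu0, hu1⟩ : 0 < u ∧ u < Γ.double i 0 := hu
      intro hrank
      have key : ∀ s' t', s' ∈ Icc 0 (Γ.double i 0) → t' ∈ Icc 0 (Γ.double i 0) →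
          s' + t' = s + u → Γ.toMetricGraph.RankAtLeast
            (triple (Γ.arc i 0 s') (Γ.arc i 0 t') (Γ.arc j 0 t)) 1 := by
        intro s' t' hs' ht' h
        refine RankAtLeast.congr ?_ (equivalent_pair (Γ := Γ.toMetricGraph) (Sum.inr (i, 0)) _
          ⟨hs0.le, hs1.le⟩ ⟨hu0.le, hu1.le⟩ hs' ht' h)
        rwa [triple_swap_right]
      -- The two chips on this edge slide apart until one reaches an end. Unless both do so
      -- together, the other is still inside the edge, and the third chip has become a vertex.
      rcases lt_trichotomy (s + u) (Γ.double i 0) with h | h | h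
      · have := key (s + u) 0 ⟨by linarith, by linarith⟩ ⟨le_rfl, by linarith⟩ (by ring)
        rw [arc_zero, triple_swap_right] at this
        exact not_rank_of_two_arcs_of_vertex hij ⟨by linarith, h⟩ ⟨ht0, ht1⟩ _ this
      · have := key 0 (Γ.double i 0) ⟨le_rfl, by linarith⟩ ⟨by linarith, le_rfl⟩ (by linarith)
        rw [arc_zero, arc_double, hj, ← spoke_single, ← spoke_zero] at this
        -- The chips at `w i` and `v j` retreat from loop i along spokes i and j. Spoke j is at
        -- least as long, so the first one gets to `v i`, a vertex of loop k.
        have := this.congr (Γ.equivalent_spokes hij (s' := 0) (t' := Γ.single i) _)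
        rw [spoke_zero] at this
        exact not_rank_of_v_spoke_arc hi hj hk ⟨ci, hij'⟩ ⟨ht0, ht1⟩ this
      · have := key (s + u - Γ.double i 0) (Γ.double i 0) ⟨by linarith, by linarith⟩
          ⟨by linarith, le_rfl⟩ (by ring)
        rw [arc_double, triple_swap_right] at this
        exact not_rank_of_two_arcs_of_vertex hij ⟨by linarith, by linarith⟩ ⟨ht0, ht1⟩ _ this
    by_cases hej : Sum.inr (j, 0) = e
    · rw [← edgePoint_inner]
      subst hej
      obtain ⟨hu0, hu1⟩ : 0 < u ∧ u < Γ.double j 0 := hu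
      intro hrank
      have key : ∀ s' t', s' ∈ Icc 0 (Γ.double j 0) → t' ∈ Icc 0 (Γ.double j 0) →
          s' + t' = t + u → Γ.toMetricGraph.RankAtLeast
            (triple (Γ.arc j 0 s') (Γ.arc j 0 t') (Γ.arc i 0 s)) 1 := by
        intro s' t' hs' ht' h
        refine RankAtLeast.congr ?_ (equivalent_pair (Γ := Γ.toMetricGraph) (Sum.inr (j, 0)) _
          ⟨ht0.le, ht1.le⟩ ⟨hu0.le, hu1.le⟩ hs' ht' h)
        rwa [triple_rotate]
      rcases lt_trichotomy (t + u) (Γ.double j 0) with h | h | h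
      · have := key (t + u) 0 ⟨by linarith, by linarith⟩ ⟨le_rfl, by linarith⟩ (by ring)
        rw [arc_zero, triple_rotate] at this
        exact not_rank_of_two_arcs_of_vertex hij ⟨hs0, hs1⟩ ⟨by linarith, h⟩ _ this
      · have := key (Γ.double j 0) 0 ⟨by linarith, le_rfl⟩ ⟨le_rfl, by linarith⟩ (by linarith)
        rw [arc_zero, arc_double, hk, ← spoke_single, ← spoke_zero] at this
        -- Likewise the chips at `v k` and `w j` retreat from loop j until the first one is at `w
        -- k`; the other one is still on spoke j because that spoke is at least as long.
        have := this.congr (Γ.equivalent_spokes hjk.symm (s' := Γ.single k)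
          (t' := Γ.single j - Γ.single k) _)
        rw [spoke_single] at this
        exact not_rank_of_w_spoke_arc hi hj hk ⟨by linarith, by linarith⟩ ⟨hs0, hs1⟩ this
      · have := key (t + u - Γ.double j 0) (Γ.double j 0) ⟨by linarith, by linarith⟩
          ⟨by linarith, le_rfl⟩ (by ring)
        rw [arc_double, triple_rotate] at this
        exact not_rank_of_two_arcs_of_vertex hij ⟨hs0, hs1⟩ ⟨by linarith, by linarith⟩ _ this
    · exact not_rank_of_two_arcs_of_edge hij ⟨hs0, hs1⟩ ⟨ht0, ht1⟩ hei hej hu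

/-! ### Genus and Brill–Noether rank -/

theorem toMetricGraph_genus (Γ : LoopOfLoops 4) : Γ.toMetricGraph.genus = 4 := by
  have hV : Fintype.card Γ.toMetricGraph.V = 6 := by
    change Fintype.card (Fin 3 ⊕ Fin 3) = 6
    simp
  have hE : Fintype.card Γ.toMetricGraph.E = 9 := by
    change Fintype.card (Fin 3 ⊕ (Fin 3 × Fin 2)) = 9
    simp
  rw [genus, hV, hE]
  norm_num

theorem exists_pair_not_le (Γ : LoopOfLoops 4) :
    ∃ p q : Γ.toMetricGraph.Point, ∀ D : Γ.toMetricGraph.Divisor, D.degree = 3 →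
      Γ.toMetricGraph.RankAtLeast D 1 → ¬ Finsupp.single p 1 + Finsupp.single q 1 ≤ D := by
  obtain ⟨j, hj⟩ := Γ.exists_longest_spoke
  have hi := Γ.double_pos (next (next j)) 0
  have hj' := Γ.double_pos j 0
  -- Any interior points of these two edges would do; midpoints are chosen. Here `next (next j)` is
  -- the index before `j`, so the two loops lie at the ends of spoke `j`.
  refine ⟨Γ.arc (next (next j)) 0 (Γ.double (next (next j)) 0 / 2), Γ.arc j 0 (Γ.double j 0 / 2),
    fun D hD hrank hle => ?_⟩
  obtain ⟨x, hx⟩ := exists_eq_single (sub_nonneg.mpr hle) (by simp [hD])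
  rw [sub_eq_iff_eq_add'] at hx
  rw [hx] at hrank
  exact not_rank_of_two_arcs (k := next j) rfl (next_next_next j) rfl (hj _) (hj _)
    ⟨by linarith, by linarith⟩ ⟨by linarith, by linarith⟩ x hrank

end LoopOfLoops

theorem mainTheorem6 (Γ : LoopOfLoops 4) :
    Γ.toMetricGraph.genus = 4 ∧
      Γ.toMetricGraph.IsBrillNoetherRank 1 3 0 ∧
      Γ.toMetricGraph.brillNoetherNumber 1 3 = 0 := by
  refine ⟨Γ.toMetricGraph_genus, Or.inl ⟨?_, ?_, ?_⟩, ?_⟩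
  · obtain ⟨D, hD, hrank⟩ := Γ.exists_rankAtLeast_one
    exact ⟨_, D, hD, hrank, rfl⟩
  -- For ρ = 0 the test divisor is a single point, and the one class already found covers it.
  · intro E h0 hE
    obtain ⟨p, rfl⟩ := MetricGraph.exists_eq_single h0 (by simpa using hE)
    obtain ⟨D, hD, hrank⟩ := Γ.exists_rankAtLeast_one
    obtain ⟨D', hD', hD'0, hp⟩ := hrank.exists_single_le p
    refine ⟨D', hD'.degree_eq.trans hD, hrank.congr hD', fun x => ?_⟩
    classical
    rw [Finsupp.single_apply]
    split_ifs with h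
    · exact h ▸ hp
    · exact hD'0 x
  -- A value ρ ≥ 1 is tested on p + q with ρ - 1 further chips at p, a divisor of degree 1 + ρ.
  · intro ρ hρ
    by_contra! hpos
    obtain ⟨p, q, hpq⟩ := Γ.exists_pair_not_le
    have hn : ∀ (x : Γ.toMetricGraph.Point) (n : ℤ), 0 ≤ n →
        (0 : Γ.toMetricGraph.Divisor) ≤ Finsupp.single x n := fun x n h =>
      Finsupp.single_nonneg.mpr h
    have hsum := add_nonneg (hn p 1 zero_le_one) (hn q 1 zero_le_one)
    have hρ1 := hn p (ρ - 1) (by omega)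
    obtain ⟨D, hD, hrank, hle⟩ := hρ
      (Finsupp.single p 1 + Finsupp.single q 1 + Finsupp.single p (ρ - 1))
      (add_nonneg hsum hρ1) (by simp; ring)
    exact hpq D hD hrank ((le_add_of_nonneg_right hρ1).trans hle)
  · rw [MetricGraph.brillNoetherNumber, Γ.toMetricGraph_genus]
    norm_num
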